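/- A \emph{parking function} of size $n$ is a Dyck path from $(0,0)$ to $(n,n)$ (with $n$ north-steps and $n$ east-steps, never going below the line $y=x$) whose north-steps are labelled bijectively by $1,\dots,n$ so that any two consecutive north-steps (with no east-step between them) have increasing labels. Let $\phi(p)\in\mathcal S_n$ be the permutation obtained by reading the labels of the north-steps of $p$ in order, and let $\mathrm{pf}_n(\rho_1,\dots,\rho_m)$ be the number of parking functions $p$ of size $n$ such that $\phi(p)$ avoids each of the permutation patterns $\rho_1,\dots,\rho_m$. Then for every $n\ge 0$ $$\mathrm{pf}_n(231,312,321)=\sum_{k=0}^{\lfloor n/2\rfloor}\frac{1}{n+1}\binom{2n-k}{n+k}\binom{n+k}{k}.$$ For every $n\ge 1$ this is also the number of dissections of a convex $(n+2)$-gon (with labelled vertices) into triangles and quadrilaterals by pairwise non-crossing diagonals. Moreover, for every $n\ge 1$ there is a bijection between the parking functions $p$ of size $n$ for which $\phi(p)$ avoids $231$, $312$ and $321$ and these dissections, under which the number of quadrilaterals of the dissection equals the number of consecutive $21$ patterns of $\phi(p)$, that is, of indices $i$ with $1\le i<n$ and $\phi(p)_i>\phi(p)_{i+1}$. -/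

import Mathlib

namespace PatternParking

/-- A labelled Dyck path of size `n`: a Dyck path with `n` north-steps (`U`) and `n` east-steps
(`D`), together with the permutation whose `i`-th entry is the label of the `i`-th north-step,
such that any two consecutive north-steps carry increasing labels. Positions and labels are
indexed from `0`. -/
structure ParkingFunction (n : ℕ) where
  path : DyckWord
  semilength_path : path.semilength = n
  /-- the permutation obtained by reading the labels of the north-steps in order -/
  perm : Equiv.Perm (Fin n)
  increasing : ∀ (l₁ l₂ : List DyckStep) (i j : Fin n),
    path.toList = l₁ ++ DyckStep.U :: DyckStep.U :: l₂ →
    (i : ℕ) = l₁.count DyckStep.U → (j : ℕ) = l₁.count DyckStep.U + 1 → perm i < perm j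

/-- `π` contains the pattern `ρ`. -/
def Contains {n m : ℕ} (π : Equiv.Perm (Fin n)) (ρ : Equiv.Perm (Fin m)) : Prop :=
  ∃ f : Fin m → Fin n, StrictMono f ∧ ∀ a b : Fin m, π (f a) ≤ π (f b) ↔ ρ a ≤ ρ b

/-- The parking functions of size `n` whose permutation avoids every pattern in `P`. -/
def AvoidingParkingFunction (n : ℕ) (P : Set ((m : ℕ) × Equiv.Perm (Fin m))) : Type :=
  {p : ParkingFunction n // ∀ ρ ∈ P, ¬ Contains p.perm ρ.2}

/-- The number of parking functions of size `n` avoiding every pattern in `P`. -/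
noncomputable def pf (n : ℕ) (P : Set ((m : ℕ) × Equiv.Perm (Fin m))) : ℕ :=
  Nat.card (AvoidingParkingFunction n P)

/-- The permutation `231`, in one-line notation with entries shifted to `0, 1, 2`. -/
def p231 : Equiv.Perm (Fin 3) := ⟨![1, 2, 0], ![2, 0, 1], by decide, by decide⟩

/-- The permutation `312`, in one-line notation with entries shifted to `0, 1, 2`. -/
def p312 : Equiv.Perm (Fin 3) := ⟨![2, 0, 1], ![1, 2, 0], by decide, by decide⟩

/-- The permutation `321`, in one-line notation with entries shifted to `0, 1, 2`. -/
def p321 : Equiv.Perm (Fin 3) := ⟨![2, 1, 0], ![2, 1, 0], by decide, by decide⟩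

/-- The set of patterns `{231, 312, 321}`. -/
def patterns : Set ((m : ℕ) × Equiv.Perm (Fin m)) := {⟨3, p231⟩, ⟨3, p312⟩, ⟨3, p321⟩}

/-- The number of consecutive `21` patterns (descents) of a permutation. -/
noncomputable def descents {n : ℕ} (π : Equiv.Perm (Fin n)) : ℕ :=
  Set.ncard {i : Fin n | ∃ j : Fin n, (j : ℕ) = i + 1 ∧ π j < π i}

/-- For `a < b`: the chord from `a` to `b` is a side of the convex polygon with vertices
`0, 1, …, N - 1` in cyclic order. -/
def IsSide {N : ℕ} (a b : Fin N) : Prop :=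
  (a : ℕ) + 1 = b ∨ ((a : ℕ) = 0 ∧ (b : ℕ) + 1 = N)

/-- A dissection of the convex polygon with labelled vertices `0, 1, …, N - 1` (in cyclic order):
a set of pairwise non-crossing diagonals. The diagonal joining `a < b` is stored as `(a, b)`. -/
structure Dissection (N : ℕ) where
  diagonals : Finset (Fin N × Fin N)
  isDiagonal : ∀ d ∈ diagonals, d.1 < d.2 ∧ ¬ IsSide d.1 d.2
  noncrossing : ∀ d ∈ diagonals, ∀ e ∈ diagonals, ¬ (d.1 < e.1 ∧ e.1 < d.2 ∧ d.2 < e.2)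

/-- For `a < b` in `S`: `a` and `b` are neighbours in the cyclic order restricted to `S`. -/
def Neighbours {N : ℕ} (S : Finset (Fin N)) (a b : Fin N) : Prop :=
  (∀ c ∈ S, ¬ (a < c ∧ c < b)) ∨ (∀ c ∈ S, ¬ (c < a ∨ b < c))

/-- `S` is the vertex set of one of the polygonal regions cut out by the dissection `D`: each edge
of the polygon spanned by `S` is a side or a chosen diagonal, and no chosen diagonal is a diagonal
of the polygon spanned by `S`. -/
def Dissection.IsRegion {N : ℕ} (D : Dissection N) (S : Finset (Fin N)) : Prop :=
  3 ≤ S.card ∧ ∀ a ∈ S, ∀ b ∈ S, a < b →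
    (Neighbours S a b ↔ (IsSide a b ∨ (a, b) ∈ D.diagonals))

/-- The dissections of a convex `N`-gon into triangles and quadrilaterals. -/
def TriQuadDissection (N : ℕ) : Type :=
  {D : Dissection N // ∀ S : Finset (Fin N), D.IsRegion S → S.card = 3 ∨ S.card = 4}

/-- The number of quadrilaterals of a dissection. -/
noncomputable def Dissection.quadrilaterals {N : ℕ} (D : Dissection N) : ℕ :=
  Set.ncard {S : Finset (Fin N) | D.IsRegion S ∧ S.card = 4}

end PatternParking

/-!
For a permutation avoiding `231`, `312` and `321`, every inversion is a pair of adjacent positions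
forming a descent, and no two descents are adjacent. Hence an avoiding parking function is a Dyck
path with a sparse set of marked north-steps, each of which is followed by an east-step; a
recursion on path prefixes counts those with `k` marks. A dissection into triangles and
quadrilaterals is dual to a plane tree with binary and ternary nodes, rooted at one side of the
polygon; such trees are counted together with forests of them, by splitting the first tree at its
root. Both families have
`1 / (n + 1) * (2 * n - k).choose (n + k) * (n + k).choose k` members with statistic `k`, and
gluing bijections between the fibres of the two statistics gives the theorem.
-/

namespace PatternParking

section Permutations

variable {n : ℕ} {π σ : Equiv.Perm (Fin n)}

/-- Entries of `π` at distance at least two appear in increasing order, so that the only inversions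
of `π` are descents. This is what avoiding `231`, `312` and `321` amounts to. -/
def NearlyIncreasing (π : Equiv.Perm (Fin n)) : Prop :=
  ∀ i l : Fin n, (i : ℕ) + 2 ≤ l → π i < π l

theorem contains_of_lt_iff_lt {m : ℕ} {ρ : Equiv.Perm (Fin m)} {f : Fin m → Fin n}
    (hf : StrictMono f) (h : ∀ a b, a < b → (π (f a) < π (f b) ↔ ρ a < ρ b)) : Contains π ρ := by
  refine ⟨f, hf, fun a b => ?_⟩
  rcases lt_trichotomy a b with hab | rfl | hba
  · rw [(π.injective.ne (hf hab).ne).le_iff_lt, (ρ.injective.ne hab.ne).le_iff_lt, h a b hab]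
  · exact iff_of_true le_rfl le_rfl
  · rw [← not_lt, ← not_lt, h b a hba]

theorem contains_of_lt_of_lt {ρ : Equiv.Perm (Fin 3)} {i j l : Fin n} (hij : i < j) (hjl : j < l)
    (h01 : π i < π j ↔ ρ 0 < ρ 1) (h12 : π j < π l ↔ ρ 1 < ρ 2) (h02 : π i < π l ↔ ρ 0 < ρ 2) :
    Contains π ρ := by
  refine contains_of_lt_iff_lt (f := ![i, j, l]) (Fin.strictMono_iff_lt_succ.2 fun a => ?_)
    fun a b hab => ?_
  · fin_cases a
    exacts [hij, hjl]
  · fin_cases a <;> fin_cases b <;>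
      first | exact h01 | exact h12 | exact h02 | exact absurd hab (by decide)

theorem NearlyIncreasing.not_contains (h : NearlyIncreasing π) {ρ : Equiv.Perm (Fin 3)}
    (hρ : ρ 2 < ρ 0) : ¬ Contains π ρ := by
  rintro ⟨f, hf, hfρ⟩
  have h01 : f 0 < f 1 := hf (by decide)
  have h12 : f 1 < f 2 := hf (by decide)
  exact hρ.not_ge ((hfρ 0 2).1 (h _ _ (by lia)).le)

theorem contains_of_inversion {i l : Fin n} (hil : (i : ℕ) + 2 ≤ l) (hinv : π l < π i) :
    Contains π p231 ∨ Contains π p312 ∨ Contains π p321 := by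
  obtain ⟨j, hij, hjl⟩ : ∃ j, i < j ∧ j < l :=
    ⟨⟨i + 1, by lia⟩, Fin.lt_def.2 (by simp), Fin.lt_def.2 (by simp; lia)⟩
  have h02 : ¬ π i < π l := hinv.not_gt
  rcases lt_or_gt_of_ne (π.injective.ne hij.ne) with hi | hi
  · exact .inl (contains_of_lt_of_lt hij hjl (iff_of_true hi (by decide))
      (iff_of_false (hinv.trans hi).not_gt (by decide)) (iff_of_false h02 (by decide)))
  · rcases lt_or_gt_of_ne (π.injective.ne hjl.ne) with hl | hl
    · exact .inr (.inl (contains_of_lt_of_lt hij hjl (iff_of_false hi.not_gt (by decide))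
        (iff_of_true hl (by decide)) (iff_of_false h02 (by decide))))
    · exact .inr (.inr (contains_of_lt_of_lt hij hjl (iff_of_false hi.not_gt (by decide))
        (iff_of_false hl.not_gt (by decide)) (iff_of_false h02 (by decide))))

theorem avoids_patterns_iff : (∀ ρ ∈ patterns, ¬ Contains π ρ.2) ↔ NearlyIncreasing π := by
  simp only [patterns, Set.mem_insert_iff, Set.mem_singleton_iff, forall_eq_or_imp, forall_eq]
  refine ⟨fun ⟨h231, h312, h321⟩ i l hil => ?_, fun h =>
    ⟨h.not_contains (by decide), h.not_contains (by decide), h.not_contains (by decide)⟩⟩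
  have hne : i ≠ l := by rintro rfl; lia
  refine (π.injective.ne hne).lt_of_le (not_lt.1 fun hinv => ?_)
  simpa [h231, h312, h321] using contains_of_inversion hil hinv

/-- The positions of the descents of `π`, as natural numbers. -/
def descentSet (π : Equiv.Perm (Fin n)) : Finset ℕ :=
  (Finset.univ.filter fun i : Fin n => ∃ j : Fin n, (j : ℕ) = i + 1 ∧ π j < π i).map
    Fin.valEmbedding

theorem mem_descentSet {x : ℕ} :
    x ∈ descentSet π ↔ ∃ i j : Fin n, (i : ℕ) = x ∧ (j : ℕ) = x + 1 ∧ π j < π i := by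
  simp only [descentSet, Finset.mem_map, Finset.mem_filter, Finset.mem_univ, true_and,
    Fin.valEmbedding_apply]
  constructor
  · rintro ⟨i, ⟨j, hj, h⟩, rfl⟩
    exact ⟨i, j, rfl, hj, h⟩
  · rintro ⟨i, j, rfl, hj, h⟩
    exact ⟨i, ⟨j, hj, h⟩, rfl⟩

theorem coe_mem_descentSet {i j : Fin n} (hij : (j : ℕ) = i + 1) :
    (i : ℕ) ∈ descentSet π ↔ π j < π i := by
  refine mem_descentSet.trans ⟨?_, fun h => ⟨i, j, rfl, hij, h⟩⟩
  rintro ⟨i', j', hi, hj, h⟩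
  rwa [Fin.ext hi, Fin.ext (hj.trans hij.symm)] at h

theorem succ_lt_of_mem_descentSet {x : ℕ} (hx : x ∈ descentSet π) : x + 1 < n := by
  obtain ⟨-, j, -, hj, -⟩ := mem_descentSet.1 hx
  exact hj ▸ j.2

theorem card_descentSet (π : Equiv.Perm (Fin n)) : (descentSet π).card = descents π := by
  rw [descentSet, Finset.card_map, descents, ← Set.ncard_coe_finset, Finset.coe_filter_univ]

theorem NearlyIncreasing.succ_notMem_descentSet (h : NearlyIncreasing π) {x : ℕ}
    (hx : x ∈ descentSet π) : x + 1 ∉ descentSet π := by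
  intro hx'
  obtain ⟨i, j, hi, hj, hij⟩ := mem_descentSet.1 hx
  obtain ⟨j', l, hj', hl, hjl⟩ := mem_descentSet.1 hx'
  obtain rfl : j = j' := Fin.ext (hj.trans hj'.symm)
  exact (h i l (by lia)).asymm (hjl.trans hij)

theorem perm_eq_of_lt_imp_lt {α : Type*} [LinearOrder α] [Finite α] {π σ : Equiv.Perm α}
    (h : ∀ i j, π i < π j → σ i < σ j) : π = σ := by
  have hmono : StrictMono (σ ∘ π.symm) := fun a b hab => h _ _ (by simpa using hab)
  ext i
  simpa using (congrFun hmono.eq_id (π i)).symm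

theorem NearlyIncreasing.eq_of_descentSet_eq (hπ : NearlyIncreasing π) (hσ : NearlyIncreasing σ)
    (h : descentSet π = descentSet σ) : π = σ := by
  refine perm_eq_of_lt_imp_lt fun i j hij => ?_
  have hne : σ i ≠ σ j := σ.injective.ne (by rintro rfl; exact hij.false)
  obtain hfar | hnext | hprev | hfar : (i : ℕ) + 2 ≤ j ∨ (j : ℕ) = i + 1 ∨ (i : ℕ) = j + 1 ∨
      (j : ℕ) + 2 ≤ i := by
    have : i ≠ j := by rintro rfl; exact hij.false
    lia
  · exact hσ i j hfar
  · exact hne.lt_of_le <| not_lt.1 fun hji =>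
      hij.asymm ((coe_mem_descentSet hnext).1 (h ▸ (coe_mem_descentSet hnext).2 hji))
  · exact (coe_mem_descentSet hprev).1 (h ▸ (coe_mem_descentSet hprev).2 hij)
  · exact absurd hij (hπ j i hfar).asymm

/-- The map exchanging `i` and `i + 1` for every `i ∈ M`, when `M` contains no two consecutive
numbers. -/
def swapAdjacent (M : Finset ℕ) (i : ℕ) : ℕ :=
  if i ∈ M then i + 1 else if 1 ≤ i ∧ i - 1 ∈ M then i - 1 else i

theorem swapAdjacent_involutive {M : Finset ℕ} (hM : ∀ i ∈ M, i + 1 ∉ M) :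
    Function.Involutive (swapAdjacent M) := by
  intro i
  by_cases h1 : i ∈ M
  · simp [swapAdjacent, h1, hM i h1]
  · by_cases h2 : 1 ≤ i ∧ i - 1 ∈ M
    · simp only [swapAdjacent, h1, h2, if_false, and_self, if_true]
      lia
    · simp [swapAdjacent, h1, h2]

theorem swapAdjacent_le (M : Finset ℕ) (i : ℕ) : swapAdjacent M i ≤ i + 1 := by
  unfold swapAdjacent; split_ifs <;> lia

theorem le_swapAdjacent (M : Finset ℕ) (i : ℕ) : i ≤ swapAdjacent M i + 1 := by
  unfold swapAdjacent; split_ifs <;> lia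

theorem swapAdjacent_lt {M : Finset ℕ} (hM : ∀ i ∈ M, i + 1 < n) {i : ℕ} (hi : i < n) :
    swapAdjacent M i < n := by
  unfold swapAdjacent
  split_ifs with h1 h2
  exacts [hM i h1, by lia, hi]

theorem swapAdjacent_succ_lt_iff {M : Finset ℕ} (hM : ∀ i ∈ M, i + 1 ∉ M) {i : ℕ} :
    swapAdjacent M (i + 1) < swapAdjacent M i ↔ i ∈ M := by
  by_cases hi : i ∈ M
  · simp [swapAdjacent, hi, hM i hi]
  · simp only [swapAdjacent, hi, if_false, Nat.add_sub_cancel, and_false, iff_false]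
    split_ifs <;> lia

/-- The permutation of `Fin n` exchanging `i` and `i + 1` for every `i ∈ M`. -/
def layeredPerm (M : Finset ℕ) (hM : ∀ i ∈ M, i + 1 ∉ M) (hn : ∀ i ∈ M, i + 1 < n) :
    Equiv.Perm (Fin n) :=
  Function.Involutive.toPerm (fun i => ⟨swapAdjacent M i, swapAdjacent_lt hn i.2⟩)
    fun i => Fin.ext (swapAdjacent_involutive hM i)

theorem coe_layeredPerm {M : Finset ℕ} (hM : ∀ i ∈ M, i + 1 ∉ M) (hn : ∀ i ∈ M, i + 1 < n)
    (i : Fin n) : (layeredPerm M hM hn i : ℕ) = swapAdjacent M i := rfl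

theorem nearlyIncreasing_layeredPerm {M : Finset ℕ} (hM : ∀ i ∈ M, i + 1 ∉ M)
    (hn : ∀ i ∈ M, i + 1 < n) : NearlyIncreasing (layeredPerm M hM hn) := by
  intro i l hil
  rw [Fin.lt_def, coe_layeredPerm, coe_layeredPerm]
  have hne : swapAdjacent M i ≠ swapAdjacent M l :=
    (swapAdjacent_involutive hM).injective.ne (by lia)
  have := swapAdjacent_le M i
  have := le_swapAdjacent M l
  lia

theorem descentSet_layeredPerm {M : Finset ℕ} (hM : ∀ i ∈ M, i + 1 ∉ M)
    (hn : ∀ i ∈ M, i + 1 < n) : descentSet (layeredPerm M hM hn) = M := by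
  ext x
  simp only [mem_descentSet, Fin.lt_def, coe_layeredPerm]
  constructor
  · rintro ⟨i, j, rfl, hj, h⟩
    rwa [hj, swapAdjacent_succ_lt_iff hM] at h
  · intro hx
    have := hn x hx
    exact ⟨⟨x, by lia⟩, ⟨x + 1, this⟩, rfl, rfl, (swapAdjacent_succ_lt_iff hM).2 hx⟩

end Permutations

section MarkedPrefixes

open DyckStep

variable {w : List DyckStep} {M : Finset ℕ} {n k d : ℕ}

/-- `w` is a prefix of a Dyck path, listed from its last step to its first, and `M` is a set of
marked north-steps of it, numbered from `0` in the order of the path, such that no two consecutive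
north-steps are marked and no marked north-step is directly followed by a north-step. -/
structure IsMarkedPrefix (w : List DyckStep) (M : Finset ℕ) : Prop where
  count_le : ∀ v, v <:+ w → v.count D ≤ v.count U
  lt_count : ∀ i ∈ M, i < w.count U
  succ_notMem : ∀ i ∈ M, i + 1 ∉ M
  count_notMem : ∀ v, U :: U :: v <:+ w → v.count U ∉ M

theorem isMarkedPrefix_nil : IsMarkedPrefix [] M ↔ M = ∅ := by
  refine ⟨fun h => Finset.eq_empty_of_forall_notMem fun i hi => by simpa using h.lt_count i hi, ?_⟩
  rintro rfl
  constructor <;> simp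

theorem isMarkedPrefix_down_cons :
    IsMarkedPrefix (D :: w) M ↔ IsMarkedPrefix w M ∧ w.count D < w.count U := by
  refine ⟨fun h => ⟨⟨fun v hv => h.count_le v (hv.trans (List.suffix_cons _ _)), by
    simpa using h.lt_count, h.succ_notMem, fun v hv => h.count_notMem v
    (hv.trans (List.suffix_cons _ _))⟩, by simpa using h.count_le _ List.suffix_rfl⟩, ?_⟩
  rintro ⟨h, hlt⟩
  refine ⟨fun v hv => ?_, by simpa using h.lt_count, h.succ_notMem, fun v hv => ?_⟩
  · rcases List.suffix_cons_iff.1 hv with rfl | hv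
    · simpa using hlt
    · exact h.count_le v hv
  · exact h.count_notMem v ((List.suffix_cons_iff.1 hv).resolve_left (by simp))

theorem isMarkedPrefix_up_cons (hM : w.count U ∉ M) :
    IsMarkedPrefix (U :: w) M ↔ IsMarkedPrefix w M ∧ ∀ v, w = U :: v → v.count U ∉ M := by
  refine ⟨fun h => ⟨⟨fun v hv => h.count_le v (hv.trans (List.suffix_cons _ _)), fun i hi => ?_,
    h.succ_notMem, fun v hv => h.count_notMem v (hv.trans (List.suffix_cons _ _))⟩, ?_⟩, ?_⟩
  · have := h.lt_count i hi
    have hne : i ≠ w.count U := fun e => hM (e ▸ hi)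
    simp only [List.count_cons_self] at this
    lia
  · rintro v rfl
    exact h.count_notMem v List.suffix_rfl
  · rintro ⟨h, hhead⟩
    refine ⟨fun v hv => ?_, fun i hi => ?_, h.succ_notMem, fun v hv => ?_⟩
    · rcases List.suffix_cons_iff.1 hv with rfl | hv
      · simpa using (h.count_le w List.suffix_rfl).trans (Nat.le_succ _)
      · exact h.count_le v hv
    · simpa using (h.lt_count i hi).trans (Nat.lt_succ_self _)
    · rcases List.suffix_cons_iff.1 hv with hv | hv
      · exact hhead v (List.cons.inj hv).2.symm
      · exact h.count_notMem v hv

theorem isMarkedPrefix_insert (hM : ∀ i ∈ M, i < w.count U) :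
    IsMarkedPrefix (U :: w) (insert (w.count U) M) ↔
      IsMarkedPrefix w M ∧ ∀ i ∈ M, i + 1 < w.count U := by
  constructor
  · refine fun h => ⟨⟨fun v hv => h.count_le v (hv.trans (List.suffix_cons _ _)), hM,
      fun i hi hi' => h.succ_notMem i (Finset.mem_insert_of_mem hi) (Finset.mem_insert_of_mem hi'),
      fun v hv hv' => h.count_notMem v (hv.trans (List.suffix_cons _ _))
        (Finset.mem_insert_of_mem hv')⟩, fun i hi => ?_⟩
    have hne : i + 1 ≠ w.count U := fun e =>
      h.succ_notMem i (Finset.mem_insert_of_mem hi) (e ▸ Finset.mem_insert_self _ _)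
    have := hM i hi
    lia
  · rintro ⟨h, hsucc⟩
    refine ⟨fun v hv => ?_, ?_, ?_, fun v hv => ?_⟩
    · rcases List.suffix_cons_iff.1 hv with rfl | hv
      · simpa using (h.count_le w List.suffix_rfl).trans (Nat.le_succ _)
      · exact h.count_le v hv
    · simpa using fun i hi => (hM i hi).trans (Nat.lt_succ_self _)
    · simp only [Finset.mem_insert, forall_eq_or_imp, not_or]
      exact ⟨⟨by lia, fun hi => absurd (hM _ hi) (by lia)⟩,
        fun i hi => ⟨(hsucc i hi).ne, h.succ_notMem i hi⟩⟩
    · rw [Finset.mem_insert, not_or]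
      rcases List.suffix_cons_iff.1 hv with hv | hv
      · obtain rfl := (List.cons.inj hv).2
        simp only [List.count_cons_self] at hsucc ⊢
        exact ⟨by lia, fun hv => by simpa using hsucc _ hv⟩
      · have := hv.sublist.count_le U
        simp only [List.count_cons_self] at this
        exact ⟨by lia, h.count_notMem v hv⟩

/-- The marked prefixes with `n` north-steps, `k` of them marked but not the last one, and `d`
east-steps. -/
def closedPrefixes (n k d : ℕ) : Set (List DyckStep × Finset ℕ) :=
  {x | IsMarkedPrefix x.1 x.2 ∧ x.1.count U = n ∧ x.1.count D = d ∧ x.2.card = k ∧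
    ∀ i ∈ x.2, i + 1 < n}

/-- The marked prefixes with `n` north-steps, `k` of them and in particular the last one marked, and
`d` east-steps. -/
def openPrefixes (n k d : ℕ) : Set (List DyckStep × Finset ℕ) :=
  {x | IsMarkedPrefix x.1 x.2 ∧ x.1.count U = n ∧ x.1.count D = d ∧ x.2.card = k ∧
    ∃ i ∈ x.2, i + 1 = n}

/-- Appends an east-step. -/
def addDown (x : List DyckStep × Finset ℕ) : List DyckStep × Finset ℕ := (D :: x.1, x.2)

/-- Appends an unmarked north-step. -/
def addUp (x : List DyckStep × Finset ℕ) : List DyckStep × Finset ℕ := (U :: x.1, x.2)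

/-- Appends a marked north-step. -/
def addMarkedUp (x : List DyckStep × Finset ℕ) : List DyckStep × Finset ℕ :=
  (U :: x.1, insert (x.1.count U) x.2)

theorem addDown_injective : Function.Injective addDown := by
  rintro ⟨w, M⟩ ⟨w', M'⟩ h
  simpa [addDown] using h

theorem addUp_injective : Function.Injective addUp := by
  rintro ⟨w, M⟩ ⟨w', M'⟩ h
  simpa [addUp] using h

theorem addMarkedUp_injOn : Set.InjOn addMarkedUp (closedPrefixes n k d) := by
  rintro ⟨w, M⟩ hM ⟨w', M'⟩ hM' h
  obtain ⟨rfl, h⟩ : w = w' ∧ insert (w.count U) M = insert (w'.count U) M' := by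
    simpa [addMarkedUp] using h
  have hw : w.count U ∉ M := fun hw => (hM.1.lt_count _ hw).false
  have hw' : w.count U ∉ M' := fun hw => (hM'.1.lt_count _ hw).false
  rw [← Finset.erase_insert hw, h, Finset.erase_insert hw']

theorem length_eq_count_add_count (w : List DyckStep) : w.length = w.count U + w.count D := by
  induction w with
  | nil => rfl
  | cons s w ih => cases s <;> simp [ih] <;> lia

theorem finite_setOf_isMarkedPrefix (n d : ℕ) :
    {x : List DyckStep × Finset ℕ |
      IsMarkedPrefix x.1 x.2 ∧ x.1.count U = n ∧ x.1.count D = d}.Finite := by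
  have : Finite DyckStep := Finite.of_injective (fun s => decide (s = U)) fun s t => by
    cases s <;> cases t <;> simp
  refine ((List.finite_length_le DyckStep (n + d)).prod
    (Finset.range n).powerset.finite_toSet).subset ?_
  rintro ⟨w, M⟩ ⟨hwM, rfl, rfl⟩
  exact ⟨(length_eq_count_add_count w).le,
    Finset.mem_coe.2 <| Finset.mem_powerset.2 fun i hi => Finset.mem_range.2 (hwM.lt_count i hi)⟩

theorem finite_closedPrefixes (n k d : ℕ) : (closedPrefixes n k d).Finite :=
  (finite_setOf_isMarkedPrefix n d).subset fun _ hx => ⟨hx.1, hx.2.1, hx.2.2.1⟩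

theorem finite_openPrefixes (n k d : ℕ) : (openPrefixes n k d).Finite :=
  (finite_setOf_isMarkedPrefix n d).subset fun _ hx => ⟨hx.1, hx.2.1, hx.2.2.1⟩

theorem closedPrefixes_zero : closedPrefixes 0 0 0 = {([], ∅)} := by
  ext ⟨w, M⟩
  simp only [closedPrefixes, Set.mem_ofPred_eq, Set.mem_singleton_iff, Prod.mk.injEq]
  constructor
  · rintro ⟨-, hU, hD, hM, -⟩
    exact ⟨List.length_eq_zero_iff.1 (by rw [length_eq_count_add_count, hU, hD]),
      Finset.card_eq_zero.1 hM⟩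
  · rintro ⟨rfl, rfl⟩
    simp [isMarkedPrefix_nil]

theorem closedPrefixes_eq_empty_of_le (hk : k ≠ 0) (hnk : n ≤ k) : closedPrefixes n k d = ∅ := by
  refine Set.eq_empty_of_forall_notMem fun x ⟨_, _, _, hcard, hlt⟩ => ?_
  have hsub : x.2 ⊆ Finset.range (n - 1) := fun i hi =>
    Finset.mem_range.2 (by have := hlt i hi; lia)
  have := Finset.card_le_card hsub
  rw [hcard, Finset.card_range] at this
  lia

theorem openPrefixes_zero (n d : ℕ) : openPrefixes n 0 d = ∅ := by
  refine Set.eq_empty_of_forall_notMem fun x ⟨_, _, _, hk, i, hi, _⟩ => ?_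
  simp [Finset.card_eq_zero.1 hk] at hi

theorem addDown_mem_closedPrefixes {x : List DyckStep × Finset ℕ} :
    addDown x ∈ closedPrefixes n k (d + 1) ↔ x ∈ closedPrefixes n k d ∧ d < n := by
  simp only [addDown, closedPrefixes, Set.mem_ofPred_eq, isMarkedPrefix_down_cons,
    List.count_cons_self, List.count_cons_of_ne (show D ≠ U by decide), Nat.add_right_cancel_iff]
  constructor
  · rintro ⟨⟨h, hlt⟩, rfl, rfl, hk⟩
    exact ⟨⟨h, rfl, rfl, hk⟩, hlt⟩
  · rintro ⟨⟨h, rfl, rfl, hk⟩, hlt⟩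
    exact ⟨⟨h, hlt⟩, rfl, rfl, hk⟩

theorem addDown_mem_openPrefixes {x : List DyckStep × Finset ℕ} :
    addDown x ∈ openPrefixes n k (d + 1) ↔ x ∈ openPrefixes n k d ∧ d < n := by
  simp only [addDown, openPrefixes, Set.mem_ofPred_eq, isMarkedPrefix_down_cons,
    List.count_cons_self, List.count_cons_of_ne (show D ≠ U by decide), Nat.add_right_cancel_iff]
  constructor
  · rintro ⟨⟨h, hlt⟩, rfl, rfl, hk⟩
    exact ⟨⟨h, rfl, rfl, hk⟩, hlt⟩
  · rintro ⟨⟨h, rfl, rfl, hk⟩, hlt⟩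
    exact ⟨⟨h, hlt⟩, rfl, rfl, hk⟩

theorem addUp_mem_closedPrefixes {x : List DyckStep × Finset ℕ} :
    addUp x ∈ closedPrefixes (n + 1) k d ↔ x ∈ closedPrefixes n k d ∨
      x ∈ openPrefixes n k d ∧ ∃ v, x.1 = D :: v := by
  obtain ⟨w, M⟩ := x
  simp only [addUp, closedPrefixes, openPrefixes, Set.mem_ofPred_eq, List.count_cons_self,
    List.count_cons_of_ne (show U ≠ D by decide), Nat.add_right_cancel_iff,
    Nat.add_lt_add_iff_right]
  constructor
  · rintro ⟨h, rfl, rfl, hk, hlt⟩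
    obtain ⟨h, hhead⟩ := (isMarkedPrefix_up_cons fun hw => (hlt _ hw).false).1 h
    by_cases hlast : ∀ i ∈ M, i + 1 < w.count U
    · exact .inl ⟨h, rfl, rfl, hk, hlast⟩
    · push Not at hlast
      obtain ⟨i, hi, hle⟩ := hlast
      have hi' : i + 1 = w.count U := le_antisymm (hlt i hi) hle
      refine .inr ⟨⟨h, rfl, rfl, hk, i, hi, hi'⟩, ?_⟩
      match w with
      | [] => simp at hi'
      | U :: v =>
        exact absurd hi (by simpa [show i = v.count U by simpa using hi'] using hhead v rfl)
      | D :: v => exact ⟨v, rfl⟩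
  · rintro (⟨h, rfl, rfl, hk, hlt⟩ | ⟨⟨h, rfl, rfl, hk, -⟩, v, rfl⟩)
    · refine ⟨(isMarkedPrefix_up_cons fun hw => (h.lt_count _ hw).false).2 ⟨h, ?_⟩, rfl, rfl, hk,
        h.lt_count⟩
      rintro v rfl hv
      simpa using hlt _ hv
    · exact ⟨(isMarkedPrefix_up_cons fun hw => (h.lt_count _ hw).false).2 ⟨h, by simp⟩, rfl, rfl,
        hk, h.lt_count⟩

theorem addMarkedUp_mem_openPrefixes {x : List DyckStep × Finset ℕ}
    (hx : ∀ i ∈ x.2, i < x.1.count U) :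
    addMarkedUp x ∈ openPrefixes (n + 1) (k + 1) d ↔ x ∈ closedPrefixes n k d := by
  have hcard : (insert (x.1.count U) x.2).card = x.2.card + 1 :=
    Finset.card_insert_of_notMem fun h => (hx _ h).false
  simp only [addMarkedUp, closedPrefixes, openPrefixes, Set.mem_ofPred_eq, List.count_cons_self,
    List.count_cons_of_ne (show U ≠ D by decide), Nat.add_right_cancel_iff,
    isMarkedPrefix_insert hx, hcard]
  constructor
  · rintro ⟨⟨h, hlt⟩, rfl, rfl, hk, -⟩
    exact ⟨h, rfl, rfl, hk, hlt⟩
  · rintro ⟨h, rfl, rfl, hk, hlt⟩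
    exact ⟨⟨h, hlt⟩, rfl, rfl, hk, _, Finset.mem_insert_self _ _, rfl⟩

theorem exists_addMarkedUp_eq (h : (U :: w, M) ∈ openPrefixes (n + 1) (k + 1) d) :
    ∃ y ∈ closedPrefixes n k d, addMarkedUp y = (U :: w, M) := by
  obtain ⟨hwM, hU, -, -, i, hi, hin⟩ := id h
  obtain rfl : i = w.count U := by simp only [List.count_cons_self] at hU; lia
  have heq : addMarkedUp (w, M.erase (w.count U)) = (U :: w, M) := by
    simp [addMarkedUp, Finset.insert_erase hi]
  refine ⟨_, (addMarkedUp_mem_openPrefixes fun i hi => ?_).1 (heq ▸ h), heq⟩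
  obtain ⟨hne, hi⟩ := Finset.mem_erase.1 hi
  have := hwM.lt_count i hi
  simp only [List.count_cons_self] at this
  lia

theorem addMarkedUp_mem_openPrefixes_of_mem {x : List DyckStep × Finset ℕ}
    (hx : x ∈ closedPrefixes n k d) : addMarkedUp x ∈ openPrefixes (n + 1) (k + 1) d :=
  (addMarkedUp_mem_openPrefixes hx.1.lt_count).2 hx

theorem closedPrefixes_succ_zero : closedPrefixes (n + 1) k 0 = addUp '' closedPrefixes n k 0 := by
  ext ⟨w, M⟩
  constructor
  · intro h
    match w with
    | [] => simpa using h.2.1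
    | D :: w => simpa using h.2.2.1
    | U :: w =>
      refine ⟨(w, M), ((addUp_mem_closedPrefixes (x := (w, M))).1 h).resolve_right ?_, rfl⟩
      rintro ⟨hopen, v, rfl⟩
      simpa using hopen.2.2.1
  · rintro ⟨x, hx, h⟩
    exact h ▸ addUp_mem_closedPrefixes.2 (.inl hx)

theorem closedPrefixes_succ_succ (hd : d < n) : closedPrefixes (n + 1) k (d + 1) =
    addDown '' closedPrefixes (n + 1) k d ∪
      (addUp '' closedPrefixes n k (d + 1) ∪ addUp ∘ addDown '' openPrefixes n k d) := by
  ext ⟨w, M⟩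
  constructor
  · intro h
    match w with
    | [] => simpa using h.2.1
    | D :: w => exact .inl ⟨(w, M), (addDown_mem_closedPrefixes.1 h).1, rfl⟩
    | U :: w =>
      rcases (addUp_mem_closedPrefixes (x := (w, M))).1 h with hclosed | ⟨hopen, v, rfl⟩
      · exact .inr (.inl ⟨(w, M), hclosed, rfl⟩)
      · exact .inr (.inr ⟨(v, M), (addDown_mem_openPrefixes.1 hopen).1, rfl⟩)
  · rintro (⟨x, hx, h⟩ | ⟨x, hx, h⟩ | ⟨x, hx, h⟩)
    · exact h ▸ addDown_mem_closedPrefixes.2 ⟨hx, hd.trans n.lt_succ_self⟩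
    · exact h ▸ addUp_mem_closedPrefixes.2 (.inl hx)
    · exact h ▸ addUp_mem_closedPrefixes.2
        (.inr ⟨addDown_mem_openPrefixes.2 ⟨hx, hd⟩, _, rfl⟩)

theorem closedPrefixes_succ_self :
    closedPrefixes (n + 1) k (n + 1) = addDown '' closedPrefixes (n + 1) k n := by
  ext ⟨w, M⟩
  constructor
  · intro h
    match w with
    | [] => simpa using h.2.1
    | D :: w => exact ⟨(w, M), (addDown_mem_closedPrefixes.1 h).1, rfl⟩
    | U :: w =>
      obtain ⟨hwM, hU, hD, -⟩ := h
      have hle := hwM.count_le w (List.suffix_cons _ _)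
      simp only [List.count_cons_self, List.count_cons_of_ne (show U ≠ D by decide)] at hU hD
      lia
  · rintro ⟨x, hx, h⟩
    exact h ▸ addDown_mem_closedPrefixes.2 ⟨hx, n.lt_succ_self⟩

theorem openPrefixes_succ_zero :
    openPrefixes (n + 1) (k + 1) 0 = addMarkedUp '' closedPrefixes n k 0 := by
  ext ⟨w, M⟩
  constructor
  · intro h
    match w with
    | [] => simpa using h.2.1
    | D :: w => simpa using h.2.2.1
    | U :: w => exact exists_addMarkedUp_eq h
  · rintro ⟨x, hx, h⟩
    exact h ▸ addMarkedUp_mem_openPrefixes_of_mem hx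

theorem openPrefixes_succ_succ (hd : d ≤ n) : openPrefixes (n + 1) (k + 1) (d + 1) =
    addDown '' openPrefixes (n + 1) (k + 1) d ∪ addMarkedUp '' closedPrefixes n k (d + 1) := by
  ext ⟨w, M⟩
  constructor
  · intro h
    match w with
    | [] => simpa using h.2.1
    | D :: w => exact .inl ⟨(w, M), (addDown_mem_openPrefixes.1 h).1, rfl⟩
    | U :: w => exact .inr (exists_addMarkedUp_eq h)
  · rintro (⟨x, hx, h⟩ | ⟨x, hx, h⟩)
    · exact h ▸ addDown_mem_openPrefixes.2 ⟨hx, Nat.lt_succ_of_le hd⟩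
    · exact h ▸ addMarkedUp_mem_openPrefixes_of_mem hx

theorem addDown_ne_addUp (x y : List DyckStep × Finset ℕ) : addDown x ≠ addUp y := by
  simp [addDown, addUp]

theorem addDown_ne_addMarkedUp (x y : List DyckStep × Finset ℕ) : addDown x ≠ addMarkedUp y := by
  simp [addDown, addMarkedUp]

theorem disjoint_closedPrefixes_openPrefixes (k k' d d' : ℕ) :
    Disjoint (closedPrefixes n k d) (openPrefixes n k' d') :=
  Set.disjoint_left.2 fun _ h ⟨_, _, _, _, _, hi, hin⟩ => (h.2.2.2.2 _ hi).ne hin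

theorem ncard_closedPrefixes_succ_zero (n k : ℕ) :
    (closedPrefixes (n + 1) k 0).ncard = (closedPrefixes n k 0).ncard := by
  rw [closedPrefixes_succ_zero, Set.ncard_image_of_injective _ addUp_injective]

theorem ncard_closedPrefixes_succ_succ (k : ℕ) (hd : d < n) :
    (closedPrefixes (n + 1) k (d + 1)).ncard = (closedPrefixes (n + 1) k d).ncard +
      ((closedPrefixes n k (d + 1)).ncard + (openPrefixes n k d).ncard) := by
  have hup := (finite_closedPrefixes n k (d + 1)).image addUp
  have hupdown := (finite_openPrefixes n k d).image (addUp ∘ addDown)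
  rw [closedPrefixes_succ_succ hd, Set.ncard_union_eq _ ((finite_closedPrefixes _ _ _).image _)
    (hup.union hupdown), Set.ncard_union_eq _ hup hupdown,
    Set.ncard_image_of_injective _ addDown_injective,
    Set.ncard_image_of_injective _ addUp_injective,
    Set.ncard_image_of_injective _ (addUp_injective.comp addDown_injective)]
  · rw [Set.image_comp, Set.disjoint_image_iff addUp_injective]
    refine (disjoint_closedPrefixes_openPrefixes k k (d + 1) (d + 1)).mono_right ?_
    rintro _ ⟨x, hx, rfl⟩
    exact addDown_mem_openPrefixes.2 ⟨hx, hd⟩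
  · rw [Set.disjoint_left]
    rintro _ ⟨x, -, rfl⟩ (⟨y, -, h⟩ | ⟨y, -, h⟩) <;> exact addDown_ne_addUp _ _ h.symm

theorem ncard_closedPrefixes_succ_self (n k : ℕ) :
    (closedPrefixes (n + 1) k (n + 1)).ncard = (closedPrefixes (n + 1) k n).ncard := by
  rw [closedPrefixes_succ_self, Set.ncard_image_of_injective _ addDown_injective]

theorem ncard_openPrefixes_succ_zero (n k : ℕ) :
    (openPrefixes (n + 1) (k + 1) 0).ncard = (closedPrefixes n k 0).ncard := by
  rw [openPrefixes_succ_zero, addMarkedUp_injOn.ncard_image]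

theorem ncard_openPrefixes_succ_succ (k : ℕ) (hd : d ≤ n) :
    (openPrefixes (n + 1) (k + 1) (d + 1)).ncard =
      (openPrefixes (n + 1) (k + 1) d).ncard + (closedPrefixes n k (d + 1)).ncard := by
  rw [openPrefixes_succ_succ hd, Set.ncard_union_eq _ ((finite_openPrefixes _ _ _).image _)
    ((finite_closedPrefixes _ _ _).image _), Set.ncard_image_of_injective _ addDown_injective,
    addMarkedUp_injOn.ncard_image]
  rw [Set.disjoint_left]
  rintro _ ⟨x, -, rfl⟩ ⟨y, -, h⟩
  exact addDown_ne_addMarkedUp _ _ h.symm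

end MarkedPrefixes

section Counting

/-- The entry `2 (j choose k) - (j - 1 choose k)` of the Pascal-type triangle with edges `1` and
`2`. It takes the place of a reflection principle in counting marked prefixes. -/
def lucasTriangle (j k : ℕ) : ℤ := 2 * j.choose k - (j - 1).choose k

theorem lucasTriangle_succ_succ {j : ℕ} (hj : j ≠ 0) (k : ℕ) :
    lucasTriangle (j + 1) (k + 1) = lucasTriangle j (k + 1) + lucasTriangle j k := by
  obtain ⟨j, rfl⟩ := Nat.exists_eq_succ_of_ne_zero hj
  simp only [lucasTriangle, Nat.succ_eq_add_one, Nat.add_sub_cancel, Nat.choose_succ_succ]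
  push_cast
  ring

theorem mul_lucasTriangle (j k : ℕ) : j * lucasTriangle j k = (j + k) * j.choose k := by
  rcases j with _ | j
  · rcases k with _ | k <;> simp [lucasTriangle]
  · have h : ((j : ℤ) + 1 - k) * (j + 1).choose k = (j + 1) * j.choose k := by
      rcases le_or_gt k (j + 1) with hk | hk
      · have := Nat.choose_mul_succ_eq j k
        zify [hk] at this
        linear_combination -this
      · simp [Nat.choose_eq_zero_of_lt hk, Nat.choose_eq_zero_of_lt (show j < k by lia)]
    simp only [lucasTriangle, Nat.add_sub_cancel]
    push_cast
    linear_combination h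

/-- The number of elements of `closedPrefixes (j + k) k d`, for `d ≤ j + k`. -/
def closedCount (j k d : ℕ) : ℤ :=
  j.choose k * (j + d).choose (j + k) - lucasTriangle j k * (j + d).choose (j + k + 1)

/-- The number of elements of `openPrefixes (j + k + 1) (k + 1) d`, for `d ≤ j + k`. -/
def openCount (j k d : ℕ) : ℤ :=
  j.choose k * (j + d + 1).choose (j + k + 1) - lucasTriangle j k * (j + d + 1).choose (j + k + 2)

theorem closedCount_zero_right (j k : ℕ) : closedCount j k 0 = if k = 0 then 1 else 0 := by
  rcases k with _ | k
  · simp [closedCount]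
  · simp [closedCount, Nat.choose_eq_zero_of_lt (show j < j + (k + 1) by lia),
      Nat.choose_eq_zero_of_lt (show j < j + (k + 1) + 1 by lia)]

theorem closedCount_zero_left (k d : ℕ) : closedCount 0 (k + 1) d = 0 := by
  simp [closedCount, lucasTriangle]

theorem openCount_zero_right (j k : ℕ) : openCount j k 0 = closedCount j k 0 := by
  rw [closedCount_zero_right]
  rcases k with _ | k
  · simp [openCount]
  · simp [openCount, Nat.choose_eq_zero_of_lt (show j + 1 < j + (k + 1) + 1 by lia),
      Nat.choose_eq_zero_of_lt (show j + 1 < j + (k + 1) + 2 by lia)]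

theorem openCount_succ (j k d : ℕ) :
    openCount j k (d + 1) = openCount j k d + closedCount j k (d + 1) := by
  simp only [openCount, closedCount, ← add_assoc, Nat.choose_succ_succ (j + d + 1)]
  push_cast
  ring

theorem closedCount_succ_zero_succ (j d : ℕ) :
    closedCount (j + 1) 0 (d + 1) = closedCount (j + 1) 0 d + closedCount j 0 (d + 1) := by
  have h1 : lucasTriangle (j + 1) 0 = 1 := by simp [lucasTriangle]
  have h2 : lucasTriangle j 0 = 1 := by simp [lucasTriangle]
  simp only [closedCount, h1, h2, Nat.choose_zero_right, add_zero,
    show j + 1 + (d + 1) = j + d + 1 + 1 by ring, show j + 1 + d = j + d + 1 by ring,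
    show j + (d + 1) = j + d + 1 by ring, Nat.choose_succ_succ (j + d + 1)]
  push_cast
  ring

theorem closedCount_succ_succ_succ {j k d : ℕ} (hd : d ≤ j + k) :
    closedCount (j + 1) (k + 1) (d + 1) =
      closedCount (j + 1) (k + 1) d + (closedCount j (k + 1) (d + 1) + openCount j k d) := by
  have hlucas : lucasTriangle (j + 1) (k + 1) * (j + d + 1).choose (j + k + 2) =
      (lucasTriangle j (k + 1) + lucasTriangle j k) * (j + d + 1).choose (j + k + 2) := by
    rcases eq_or_ne j 0 with rfl | hj
    · rw [Nat.choose_eq_zero_of_lt (by lia)]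
      simp
    · rw [lucasTriangle_succ_succ hj]
  simp only [closedCount, openCount, show j + 1 + (d + 1) = j + d + 1 + 1 by ring,
    show j + 1 + d = j + d + 1 by ring, show j + (d + 1) = j + d + 1 by ring,
    show j + 1 + (k + 1) = j + k + 1 + 1 by ring, show j + (k + 1) = j + k + 1 by ring,
    Nat.choose_succ_succ (j + d + 1), Nat.choose_succ_succ j]
  push_cast
  linear_combination -hlucas

theorem add_mul_choose_succ (j n : ℕ) :
    ((n : ℤ) + 1) * (j + n).choose (n + 1) = j * (j + n).choose n := by
  have := Nat.choose_succ_right_eq (j + n) n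
  rw [Nat.add_sub_cancel] at this
  zify at this
  linear_combination this

theorem closedCount_self {j k n : ℕ} (hn : j + k = n + 1) :
    closedCount j k (n + 1) = closedCount j k n := by
  have hn' : (j : ℤ) + k = n + 1 := by exact_mod_cast hn
  have hchoose := add_mul_choose_succ j n
  have hpos : (n : ℤ) + 1 ≠ 0 := by positivity
  simp only [closedCount, hn, ← add_assoc, Nat.choose_succ_succ (j + n)]
  push_cast
  apply mul_left_cancel₀ hpos
  linear_combination (-((j + n).choose n : ℤ)) * mul_lucasTriangle j k
    - (j.choose k * (j + n).choose n : ℤ) * hn' - lucasTriangle j k * hchoose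

theorem succ_mul_closedCount_self (j k : ℕ) :
    ((j : ℤ) + k + 1) * closedCount j k (j + k) = j.choose k * (2 * j + k).choose (j + k) := by
  have hchoose := add_mul_choose_succ j (j + k)
  push_cast at hchoose
  simp only [closedCount, show 2 * j + k = j + (j + k) by ring]
  linear_combination (-((j + (j + k)).choose (j + k) : ℤ)) * mul_lucasTriangle j k
    - lucasTriangle j k * hchoose

theorem ncard_openPrefixes_of_closedPrefixes {j k : ℕ}
    (hclosed : ∀ d ≤ j + k, ((closedPrefixes (j + k) k d).ncard : ℤ) = closedCount j k d) {d : ℕ}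
    (hd : d ≤ j + k) : ((openPrefixes (j + k + 1) (k + 1) d).ncard : ℤ) = openCount j k d := by
  induction d with
  | zero => rw [ncard_openPrefixes_succ_zero, hclosed 0 hd, openCount_zero_right]
  | succ d ih =>
    rw [ncard_openPrefixes_succ_succ _ (by lia), openCount_succ]
    push_cast
    rw [ih (by lia), hclosed _ hd]

theorem ncard_closedPrefixes_succ {j k : ℕ} (ih : ∀ j' k', j' + k' ≤ j + k → ∀ d ≤ j' + k',
      ((closedPrefixes (j' + k') k' d).ncard : ℤ) = closedCount j' k' d) {d : ℕ}
    (hd : d ≤ j + k + 1) :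
    ((closedPrefixes (j + k + 1) k d).ncard : ℤ) = closedCount (j + 1) k d := by
  induction d with
  | zero =>
    rw [ncard_closedPrefixes_succ_zero, ih j k le_rfl 0 (Nat.zero_le _), closedCount_zero_right,
      closedCount_zero_right]
  | succ d ihd =>
    specialize ihd (by lia)
    obtain rfl | hd : d = j + k ∨ d < j + k := by lia
    · rw [ncard_closedPrefixes_succ_self, ihd, closedCount_self (by lia)]
    · rw [ncard_closedPrefixes_succ_succ k hd]
      push_cast
      rw [ihd, ih j k le_rfl _ hd]
      rcases k with _ | k
      · simp [openPrefixes_zero, closedCount_succ_zero_succ]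
      · rw [← add_assoc j k 1, ncard_openPrefixes_of_closedPrefixes (ih j k (by lia)) (by lia),
          closedCount_succ_succ_succ (by lia)]

theorem ncard_closedPrefixes :
    ∀ j k d : ℕ, d ≤ j + k → ((closedPrefixes (j + k) k d).ncard : ℤ) = closedCount j k d
  | 0, 0, d, hd => by
    obtain rfl : d = 0 := by lia
    simp [closedPrefixes_zero, closedCount]
  | 0, k + 1, d, _ => by
    rw [closedPrefixes_eq_empty_of_le k.succ_ne_zero (by lia), closedCount_zero_left]
    simp
  | j + 1, k, d, hd => by
    rw [Nat.add_right_comm] at hd ⊢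
    exact ncard_closedPrefixes_succ (fun j' k' _ d hd => ncard_closedPrefixes j' k' d hd) hd
termination_by j k => j + k

theorem choose_add_mul_choose (n k : ℕ) :
    (2 * n - k).choose (n + k) * (n + k).choose k = (n - k).choose k * (2 * n - k).choose n := by
  have := Nat.choose_mul (n := 2 * n - k) (k := n + k) (s := n) (by lia)
  rw [Nat.choose_symm_add] at this
  rw [this, mul_comm, show 2 * n - k - n = n - k by lia, Nat.add_sub_cancel_left]

theorem succ_mul_ncard_closedPrefixes (n k : ℕ) : (n + 1) * (closedPrefixes n k n).ncard =
    (2 * n - k).choose (n + k) * (n + k).choose k := by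
  rw [choose_add_mul_choose]
  rcases lt_or_ge n k with hlt | hle
  · simp [closedPrefixes_eq_empty_of_le (show k ≠ 0 by lia) hlt.le,
      Nat.choose_eq_zero_of_lt (show n - k < k by lia)]
  · have h := succ_mul_closedCount_self (n - k) k
    rw [← ncard_closedPrefixes _ _ _ le_rfl, Nat.sub_add_cancel hle,
      show 2 * (n - k) + k = 2 * n - k by lia] at h
    zify [hle] at h ⊢
    simpa using h

end Counting

section ParkingFunctions

open DyckStep

variable {n k : ℕ}

instance finite_parkingFunction (n : ℕ) : Finite (ParkingFunction n) :=
  Finite.of_injective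
    (β := {path : DyckWord // path.semilength = n} × Equiv.Perm (Fin n))
    (fun p => (⟨p.path, p.semilength_path⟩, p.perm)) <| by
      rintro ⟨path, _, π, _⟩ ⟨path', _, π', _⟩ h
      simpa using h

instance finite_avoidingParkingFunction (n : ℕ) (P : Set ((m : ℕ) × Equiv.Perm (Fin m))) :
    Finite (AvoidingParkingFunction n P) :=
  Subtype.finite

namespace ParkingFunction

/-- The path of `p`, last step first, with the descents of the permutation of `p` as marked
north-steps. -/
def markedPath (p : ParkingFunction n) : List DyckStep × Finset ℕ :=
  (p.path.toList.reverse, descentSet p.perm)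

theorem count_U_eq (p : ParkingFunction n) : p.path.toList.count U = n := p.semilength_path

theorem isMarkedPrefix_markedPath {p : ParkingFunction n} (hp : NearlyIncreasing p.perm) :
    IsMarkedPrefix p.path.toList.reverse (descentSet p.perm) where
  count_le v hv := by
    rw [← List.reverse_prefix, List.reverse_reverse] at hv
    have := p.path.count_D_le_count_U v.reverse.length
    rw [← List.prefix_iff_eq_take.1 hv] at this
    simpa using this
  lt_count i hi := by
    rw [List.count_reverse, p.count_U_eq]
    exact (Nat.lt_succ_self i).trans (succ_lt_of_mem_descentSet hi)
  succ_notMem i hi := hp.succ_notMem_descentSet hi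
  count_notMem v := by
    rintro ⟨l, h⟩ hv
    obtain ⟨i, j, hi, hj, hij⟩ := mem_descentSet.1 hv
    have hpath : p.path.toList = v.reverse ++ U :: U :: l.reverse := by
      rw [← List.reverse_reverse p.path.toList, ← h]
      simp
    exact hij.asymm (p.increasing _ _ i j hpath (by simpa using hi) (by simpa using hj))

theorem markedPath_mem_closedPrefixes {p : ParkingFunction n} (hp : NearlyIncreasing p.perm) :
    p.markedPath ∈ closedPrefixes n (descents p.perm) n := by
  refine ⟨isMarkedPrefix_markedPath hp, ?_, ?_, card_descentSet p.perm,
    fun i hi => succ_lt_of_mem_descentSet hi⟩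
  · rw [markedPath, List.count_reverse, p.count_U_eq]
  · rw [markedPath, List.count_reverse, ← p.path.count_U_eq_count_D, p.count_U_eq]

theorem eq_of_markedPath_eq {p q : ParkingFunction n} (hp : NearlyIncreasing p.perm)
    (hq : NearlyIncreasing q.perm) (h : p.markedPath = q.markedPath) : p = q := by
  obtain ⟨path, _, π, _⟩ := p
  obtain ⟨path', _, π', _⟩ := q
  obtain ⟨hpath, hset⟩ := Prod.mk.inj h
  obtain rfl : path = path' := DyckWord.ext (List.reverse_injective hpath)
  obtain rfl : π = π' := hp.eq_of_descentSet_eq hq hset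
  rfl

end ParkingFunction

/-- The Dyck word underlying a marked Dyck path. -/
def dyckWordOfClosedPrefix {x : List DyckStep × Finset ℕ} (hx : x ∈ closedPrefixes n k n) :
    DyckWord where
  toList := x.1.reverse
  count_U_eq_count_D := by rw [List.count_reverse, List.count_reverse, hx.2.1, hx.2.2.1]
  count_D_le_count_U i := by
    have := hx.1.count_le (x.1.reverse.take i).reverse
      (by rw [← List.reverse_prefix, List.reverse_reverse]; exact List.take_prefix _ _)
    simpa using this

/-- The parking function whose path is the given marked Dyck path and whose permutation exchanges
the entries at each marked position and the next one. -/
def parkingFunctionOfClosedPrefix {x : List DyckStep × Finset ℕ}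
    (hx : x ∈ closedPrefixes n k n) : ParkingFunction n where
  path := dyckWordOfClosedPrefix hx
  semilength_path := by
    simp only [dyckWordOfClosedPrefix, DyckWord.semilength, List.count_reverse]
    exact hx.2.1
  perm := layeredPerm x.2 hx.1.succ_notMem hx.2.2.2.2
  increasing l₁ l₂ i j h hi hj := by
    have hv : U :: U :: l₁.reverse <:+ x.1 := by
      refine ⟨l₂.reverse, List.reverse_injective ?_⟩
      rw [show x.1.reverse = _ from h]
      simp
    have hnotMem := hx.1.count_notMem _ hv
    rw [List.count_reverse, ← hi, ← descentSet_layeredPerm hx.1.succ_notMem hx.2.2.2.2,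
      coe_mem_descentSet (show (j : ℕ) = i + 1 by lia), not_lt] at hnotMem
    exact hnotMem.lt_of_ne ((Equiv.injective _).ne (by rintro rfl; lia))

theorem markedPath_parkingFunctionOfClosedPrefix {x : List DyckStep × Finset ℕ}
    (hx : x ∈ closedPrefixes n k n) : (parkingFunctionOfClosedPrefix hx).markedPath = x := by
  simp [ParkingFunction.markedPath, parkingFunctionOfClosedPrefix, dyckWordOfClosedPrefix,
    descentSet_layeredPerm]

theorem descents_parkingFunctionOfClosedPrefix {x : List DyckStep × Finset ℕ}
    (hx : x ∈ closedPrefixes n k n) : descents (parkingFunctionOfClosedPrefix hx).perm = k := by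
  rw [← card_descentSet, parkingFunctionOfClosedPrefix, descentSet_layeredPerm]
  exact hx.2.2.2.1

theorem card_avoiding_with_descents (n k : ℕ) :
    Nat.card {p : AvoidingParkingFunction n patterns // descents p.1.perm = k} =
      (closedPrefixes n k n).ncard := by
  rw [← Nat.card_coe_set_eq]
  refine Nat.card_eq_of_bijective (fun p => ⟨p.1.1.markedPath, by
    simpa only [p.2] using
      ParkingFunction.markedPath_mem_closedPrefixes (avoids_patterns_iff.1 p.1.2)⟩) ⟨?_, ?_⟩
  · rintro ⟨⟨p, hp⟩, _⟩ ⟨⟨q, hq⟩, _⟩ h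
    obtain rfl := ParkingFunction.eq_of_markedPath_eq (avoids_patterns_iff.1 hp)
      (avoids_patterns_iff.1 hq) (congrArg Subtype.val h)
    rfl
  · rintro ⟨x, hx⟩
    exact ⟨⟨⟨parkingFunctionOfClosedPrefix hx,
      avoids_patterns_iff.2 (nearlyIncreasing_layeredPerm hx.1.succ_notMem hx.2.2.2.2)⟩,
      descents_parkingFunctionOfClosedPrefix hx⟩,
      Subtype.ext (markedPath_parkingFunctionOfClosedPrefix hx)⟩

end ParkingFunctions

/-- Plane trees all of whose inner vertices have two or three children. -/
inductive BTTree : Type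
  | leaf : BTTree
  | tri : BTTree → BTTree → BTTree
  | quad : BTTree → BTTree → BTTree → BTTree

namespace BTTree

/-- The number of inner vertices with two children. -/
def tris : BTTree → ℕ
  | leaf => 0
  | tri l r => l.tris + r.tris + 1
  | quad l c r => l.tris + c.tris + r.tris

/-- The number of inner vertices with three children. -/
def quads : BTTree → ℕ
  | leaf => 0
  | tri l r => l.quads + r.quads
  | quad l c r => l.quads + c.quads + r.quads + 1

/-- The number of leaves. -/
def leaves : BTTree → ℕ
  | leaf => 1
  | tri l r => l.leaves + r.leaves
  | quad l c r => l.leaves + c.leaves + r.leaves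

theorem leaves_eq (t : BTTree) : t.leaves = t.tris + 2 * t.quads + 1 := by
  induction t <;> simp only [leaves, tris, quads] <;> lia

theorem leaves_pos (t : BTTree) : 0 < t.leaves := by
  rw [leaves_eq]
  lia

/-- The plane forests with `h` trees, `u` binary and `v` ternary inner vertices. -/
def forests (h u v : ℕ) : Set (List BTTree) :=
  {l | l.length = h ∧ (l.map tris).sum = u ∧ (l.map quads).sum = v}

theorem mem_forests {h u v : ℕ} {l : List BTTree} :
    l ∈ forests h u v ↔ l.length = h ∧ (l.map tris).sum = u ∧ (l.map quads).sum = v := Iff.rfl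

theorem forests_zero_zero_zero : forests 0 0 0 = {[]} := by
  ext l
  simp only [mem_forests, Set.mem_singleton_iff]
  constructor
  · rintro ⟨h, -, -⟩
    exact List.length_eq_zero_iff.1 h
  · rintro rfl
    simp

theorem forests_zero_of_ne {u v : ℕ} (h : u ≠ 0 ∨ v ≠ 0) : forests 0 u v = ∅ := by
  refine Set.eq_empty_of_forall_notMem fun l hl => ?_
  obtain ⟨h1, h2, h3⟩ := hl
  obtain rfl := List.length_eq_zero_iff.1 h1
  simp only [List.map_nil, List.sum_nil] at h2 h3
  lia

/-- Forests whose first tree has a binary root. -/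
def triForests (h u v : ℕ) : Set (List BTTree) :=
  {l | l ∈ forests (h + 1) u v ∧ ∃ a b l', l = tri a b :: l'}

/-- Forests whose first tree has a ternary root. -/
def quadForests (h u v : ℕ) : Set (List BTTree) :=
  {l | l ∈ forests (h + 1) u v ∧ ∃ a b c l', l = quad a b c :: l'}

theorem forests_succ (h u v : ℕ) : forests (h + 1) u v =
    List.cons leaf '' forests h u v ∪ (triForests h u v ∪ quadForests h u v) := by
  ext l
  constructor
  · intro hl
    rcases l with _ | ⟨t, l⟩
    · simp [mem_forests] at hl
    · cases t with
      | leaf =>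
        refine Or.inl ⟨l, ?_, rfl⟩
        simpa [mem_forests, tris, quads] using hl
      | tri a b => exact Or.inr (Or.inl ⟨hl, a, b, l, rfl⟩)
      | quad a b c => exact Or.inr (Or.inr ⟨hl, a, b, c, l, rfl⟩)
  · rintro (⟨l, hl, rfl⟩ | hl | hl)
    · simpa [mem_forests, tris, quads] using hl
    · exact hl.1
    · exact hl.1

/-- Replaces the first two trees by a tree with a binary root. -/
def joinTri : List BTTree → List BTTree
  | a :: b :: l => tri a b :: l
  | l => l

/-- Replaces the first three trees by a tree with a ternary root. -/
def joinQuad : List BTTree → List BTTree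
  | a :: b :: c :: l => quad a b c :: l
  | l => l

theorem exists_cons_cons {h u v : ℕ} {l : List BTTree} (hl : l ∈ forests (h + 2) u v) :
    ∃ a b l', l = a :: b :: l' := by
  rcases l with _ | ⟨a, _ | ⟨b, l⟩⟩
  · simp [mem_forests] at hl
  · simp [mem_forests] at hl
  · exact ⟨a, b, l, rfl⟩

theorem exists_cons_cons_cons {h u v : ℕ} {l : List BTTree} (hl : l ∈ forests (h + 3) u v) :
    ∃ a b c l', l = a :: b :: c :: l' := by
  rcases l with _ | ⟨a, _ | ⟨b, _ | ⟨c, l⟩⟩⟩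
  · simp [mem_forests] at hl
  · simp [mem_forests] at hl
  · simp [mem_forests] at hl
  · exact ⟨a, b, c, l, rfl⟩

theorem triForests_zero (h v : ℕ) : triForests h 0 v = ∅ := by
  refine Set.eq_empty_of_forall_notMem ?_
  rintro _ ⟨hl, a, b, l, rfl⟩
  simp [mem_forests, tris] at hl

theorem quadForests_zero (h u : ℕ) : quadForests h u 0 = ∅ := by
  refine Set.eq_empty_of_forall_notMem ?_
  rintro _ ⟨hl, a, b, c, l, rfl⟩
  simp [mem_forests, quads] at hl

theorem triForests_succ (h u v : ℕ) :
    triForests h (u + 1) v = joinTri '' forests (h + 2) u v := by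
  ext l
  constructor
  · rintro ⟨hl, a, b, l, rfl⟩
    refine ⟨a :: b :: l, ?_, rfl⟩
    simp only [mem_forests, List.length_cons, List.map_cons, List.sum_cons, tris, quads] at hl ⊢
    lia
  · rintro ⟨l, hl, rfl⟩
    obtain ⟨a, b, l, rfl⟩ := exists_cons_cons hl
    refine ⟨?_, a, b, l, rfl⟩
    simp only [joinTri, mem_forests, List.length_cons, List.map_cons, List.sum_cons, tris,
      quads] at hl ⊢
    lia

theorem quadForests_succ (h u v : ℕ) :
    quadForests h u (v + 1) = joinQuad '' forests (h + 3) u v := by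
  ext l
  constructor
  · rintro ⟨hl, a, b, c, l, rfl⟩
    refine ⟨a :: b :: c :: l, ?_, rfl⟩
    simp only [mem_forests, List.length_cons, List.map_cons, List.sum_cons, tris, quads] at hl ⊢
    lia
  · rintro ⟨l, hl, rfl⟩
    obtain ⟨a, b, c, l, rfl⟩ := exists_cons_cons_cons hl
    refine ⟨?_, a, b, c, l, rfl⟩
    simp only [joinQuad, mem_forests, List.length_cons, List.map_cons, List.sum_cons, tris,
      quads] at hl ⊢
    lia

theorem injOn_joinTri (h u v : ℕ) : Set.InjOn joinTri (forests (h + 2) u v) := by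
  intro l hl l' hl' e
  obtain ⟨a, b, l, rfl⟩ := exists_cons_cons hl
  obtain ⟨a', b', l', rfl⟩ := exists_cons_cons hl'
  simpa [joinTri, and_assoc] using e

theorem injOn_joinQuad (h u v : ℕ) : Set.InjOn joinQuad (forests (h + 3) u v) := by
  intro l hl l' hl' e
  obtain ⟨a, b, c, l, rfl⟩ := exists_cons_cons_cons hl
  obtain ⟨a', b', c', l', rfl⟩ := exists_cons_cons_cons hl'
  simpa [joinQuad, and_assoc] using e

theorem finite_forests (h u v : ℕ) : (forests h u v).Finite := by
  induction hm : h + 2 * u + 3 * v using Nat.strong_induction_on generalizing h u v with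
  | _ m ih =>
    rcases h with _ | h
    · refine (Set.finite_singleton []).subset fun l hl => ?_
      exact List.length_eq_zero_iff.1 hl.1
    · rw [forests_succ]
      refine ((ih _ (by lia) h u v rfl).image _).union (Set.Finite.union ?_ ?_)
      · rcases u with _ | u
        · rw [triForests_zero]
          exact Set.finite_empty
        · rw [triForests_succ]
          exact (ih _ (by lia) (h + 2) u v rfl).image _
      · rcases v with _ | v
        · rw [quadForests_zero]
          exact Set.finite_empty
        · rw [quadForests_succ]
          exact (ih _ (by lia) (h + 3) u v rfl).image _

theorem ncard_forests_succ (h u v : ℕ) : (forests (h + 1) u v).ncard =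
    (forests h u v).ncard + ((triForests h u v).ncard + (quadForests h u v).ncard) := by
  have hf := finite_forests (h + 1) u v
  have h1 : (triForests h u v).Finite := hf.subset fun l hl => hl.1
  have h2 : (quadForests h u v).Finite := hf.subset fun l hl => hl.1
  rw [forests_succ, Set.ncard_union_eq _ ((finite_forests _ _ _).image _) (h1.union h2),
    Set.ncard_union_eq _ h1 h2, Set.ncard_image_of_injective _ List.cons_injective]
  · rw [Set.disjoint_left]
    rintro _ ⟨-, a, b, l, rfl⟩ ⟨-, a', b', c', l', h'⟩
    simp at h'
  · rw [Set.disjoint_left]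
    rintro _ ⟨l, -, rfl⟩ (⟨-, a, b, l', h'⟩ | ⟨-, a, b, c, l', h'⟩) <;> simp at h'

theorem ncard_triForests_succ (h u v : ℕ) :
    (triForests h (u + 1) v).ncard = (forests (h + 2) u v).ncard := by
  rw [triForests_succ, (injOn_joinTri h u v).ncard_image]

theorem ncard_quadForests_succ (h u v : ℕ) :
    (quadForests h u (v + 1)).ncard = (forests (h + 3) u v).ncard := by
  rw [quadForests_succ, (injOn_joinQuad h u v).ncard_image]

open Nat in
theorem ncard_triForests_mul {h u v m : ℕ}
    (ih : ∀ x, u = x + 1 → (forests (h + 2) x v).ncard * ((h + 2 + x + 2 * v)! * x ! * v !) =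
      (h + 2) * m !) :
    (triForests h u v).ncard * ((h + 1 + u + 2 * v)! * u ! * v !) = (h + 2) * u * m ! := by
  rcases u with _ | u
  · simp [triForests_zero]
  · rw [ncard_triForests_succ, Nat.factorial_succ u,
      show h + 1 + (u + 1) + 2 * v = h + 2 + u + 2 * v by ring]
    linear_combination (u + 1) * ih u rfl

open Nat in
theorem ncard_quadForests_mul {h u v m : ℕ}
    (ih : ∀ y, v = y + 1 → (forests (h + 3) u y).ncard * ((h + 3 + u + 2 * y)! * u ! * y !) =
      (h + 3) * m !) :
    (quadForests h u v).ncard * ((h + 1 + u + 2 * v)! * u ! * v !) = (h + 3) * v * m ! := by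
  rcases v with _ | v
  · simp [quadForests_zero]
  · rw [ncard_quadForests_succ, Nat.factorial_succ v,
      show h + 1 + u + 2 * (v + 1) = h + 3 + u + 2 * v by ring]
    linear_combination (v + 1) * ih v rfl

open Nat in
theorem ncard_forests_mul (h u v : ℕ) :
    (forests (h + 1) u v).ncard * ((h + 1 + u + 2 * v)! * u ! * v !) =
      (h + 1) * (h + 2 * u + 3 * v)! := by
  induction hm : h + 2 * u + 3 * v using Nat.strong_induction_on generalizing h u v with
  | _ m ih =>
    rcases m with _ | m
    · obtain ⟨rfl, rfl, rfl⟩ : h = 0 ∧ u = 0 ∧ v = 0 := by lia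
      simp [ncard_forests_succ, triForests_zero, quadForests_zero, forests_zero_zero_zero]
    have hleaf : (forests h u v).ncard * ((h + 1 + u + 2 * v)! * u ! * v !) =
        h * (h + 1 + u + 2 * v) * m ! := by
      rcases h with _ | h
      · simp [forests_zero_of_ne (show u ≠ 0 ∨ v ≠ 0 by lia)]
      · rw [show h + 1 + 1 + u + 2 * v = (h + 1 + u + 2 * v) + 1 by ring, Nat.factorial_succ]
        linear_combination (h + 1 + u + 2 * v + 1) * ih m m.lt_succ_self h u v (by lia)
    have htri := ncard_triForests_mul (h := h) (u := u) (v := v) (m := m) fun x hx =>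
      ih m m.lt_succ_self (h + 1) x v (by lia)
    have hquad := ncard_quadForests_mul (h := h) (u := u) (v := v) (m := m) fun y hy =>
      ih m m.lt_succ_self (h + 2) u y (by lia)
    rw [ncard_forests_succ, add_mul, add_mul, hleaf, htri, hquad, Nat.factorial_succ, ← hm]
    ring

/-- The trees with `n + 1` leaves and `k` ternary vertices. -/
def treesWith (n k : ℕ) : Set BTTree := {t | t.leaves = n + 1 ∧ t.quads = k}

theorem treesWith_eq_empty {n k : ℕ} (h : n < 2 * k) : treesWith n k = ∅ := by
  refine Set.eq_empty_of_forall_notMem fun t ⟨hleaves, hquads⟩ => ?_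
  rw [leaves_eq] at hleaves
  lia

theorem forests_one (u v : ℕ) :
    forests 1 u v = (fun t => [t]) '' treesWith (u + 2 * v) v := by
  ext l
  constructor
  · rintro ⟨hlength, htris, hquads⟩
    obtain ⟨t, rfl⟩ := List.length_eq_one_iff.1 hlength
    simp only [List.map_cons, List.map_nil, List.sum_cons, List.sum_nil] at htris hquads
    exact ⟨t, ⟨by rw [leaves_eq]; lia, hquads⟩, rfl⟩
  · rintro ⟨t, ⟨hleaves, hquads⟩, rfl⟩
    rw [leaves_eq] at hleaves
    simp only [mem_forests, List.length_singleton, List.map_cons, List.map_nil, List.sum_cons,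
      List.sum_nil, true_and, add_zero]
    lia

theorem ncard_forests_one (u v : ℕ) :
    (forests 1 u v).ncard = (treesWith (u + 2 * v) v).ncard := by
  rw [forests_one, Set.ncard_image_of_injective _ List.singleton_injective]

open Nat in
theorem succ_mul_ncard_treesWith (n k : ℕ) :
    (n + 1) * (treesWith n k).ncard = (2 * n - k).choose (n + k) * (n + k).choose k := by
  rcases Nat.lt_or_ge n (2 * k) with h | h
  · rw [treesWith_eq_empty h, Set.ncard_empty, Nat.choose_eq_zero_of_lt (by lia), zero_mul,
      mul_zero]
  obtain ⟨u, rfl⟩ := Nat.exists_eq_add_of_le' h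
  have htrees := ncard_forests_mul 0 u k
  rw [ncard_forests_one, show 0 + 1 + u + 2 * k = u + 2 * k + 1 by ring, Nat.factorial_succ,
    zero_add, zero_add, one_mul] at htrees
  have hinner := Nat.add_choose_mul_factorial_mul_factorial u k
  have hall := Nat.add_choose_mul_factorial_mul_factorial (u + k) (u + 2 * k)
  rw [choose_add_mul_choose, show u + 2 * k - k = u + k by lia,
    show 2 * (u + 2 * k) - k = (u + k) + (u + 2 * k) by lia]
  have hpos : 0 < (u + 2 * k)! * u ! * k ! := by positivity
  refine Nat.eq_of_mul_eq_mul_right hpos ?_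
  calc _ = (2 * u + 3 * k)! := by rw [← htrees]; ring
    _ = _ := by
      rw [show 2 * u + 3 * k = (u + k) + (u + 2 * k) by ring, ← hall, ← hinner]; ring

end BTTree

section ArcSystems

/-- Adjacency in the cyclic order restricted to `S`; the analogue on `ℕ` of `Neighbours`. -/
def Adjacent (S : Finset ℕ) (x y : ℕ) : Prop :=
  (∀ c ∈ S, ¬ (x < c ∧ c < y)) ∨ (∀ c ∈ S, ¬ (c < x ∨ y < c))

/-- `S` is the vertex set of a region bounded by the arcs in `E`; the analogue on `ℕ` of
`Dissection.IsRegion`, with the sides counted among the arcs. -/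
def IsCell (E : Finset (ℕ × ℕ)) (S : Finset ℕ) : Prop :=
  3 ≤ S.card ∧ ∀ x ∈ S, ∀ y ∈ S, x < y → (Adjacent S x y ↔ (x, y) ∈ E)

/-- `E` is a set of non-crossing arcs on the points `a, a + 1, …, b`, containing all arcs between
consecutive points. The arc `(a, b)` may be missing: systems with this arc are the dissections of
the polygon on these points, and systems without it arise by cutting off the base of a polygon. -/
structure ArcSystem (a b : ℕ) (E : Finset (ℕ × ℕ)) : Prop where
  le : a ≤ b
  bounds : ∀ i j, (i, j) ∈ E → a ≤ i ∧ i < j ∧ j ≤ b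
  side : ∀ i, a ≤ i → i < b → (i, i + 1) ∈ E
  noncrossing : ∀ i j k l, (i, j) ∈ E → (k, l) ∈ E → i < k → k < j → l ≤ j

/-- The arcs of `E` with both ends in `[x, y]`. -/
def within (E : Finset (ℕ × ℕ)) (x y : ℕ) : Finset (ℕ × ℕ) :=
  E.filter fun p => x ≤ p.1 ∧ p.2 ≤ y

/-- The points of `[a, b]` that are not strictly below an arc of `E`. -/
def visible (a b : ℕ) (E : Finset (ℕ × ℕ)) : Finset ℕ :=
  (Finset.Icc a b).filter fun v => ∀ p ∈ E, ¬ (p.1 < v ∧ v < p.2)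

variable {a b b' c c' i j v x y : ℕ} {E E₁ E₂ E₁' E₂' : Finset (ℕ × ℕ)} {S : Finset ℕ}

theorem mem_within : (i, j) ∈ within E x y ↔ (i, j) ∈ E ∧ x ≤ i ∧ j ≤ y := by
  simp [within]

theorem within_subset : within E x y ⊆ E := Finset.filter_subset _ _

theorem mem_visible :
    v ∈ visible a b E ↔ (a ≤ v ∧ v ≤ b) ∧ ∀ i j, (i, j) ∈ E → ¬ (i < v ∧ v < j) := by
  simp [visible]

theorem within_union_within (hc : c ∈ visible a b E) (hxc : x ≤ c) (hcy : c ≤ y) :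
    within E x c ∪ within E c y = within E x y := by
  ext ⟨i, j⟩
  rw [Finset.mem_union, mem_within, mem_within, mem_within]
  have := (mem_visible.1 hc).2 i j
  constructor
  · rintro (⟨h, _, _⟩ | ⟨h, _, _⟩) <;> exact ⟨h, by lia, by lia⟩
  · rintro ⟨h, _, _⟩
    have := this h
    rw [← and_or_left]
    exact ⟨h, by lia⟩

theorem isCell_within (hS : S ⊆ Finset.Icc x y) : IsCell (within E x y) S ↔ IsCell E S := by
  refine and_congr_right fun _ => forall₂_congr fun i hi => forall₂_congr fun j hj => ?_
  rw [mem_within, and_iff_left ⟨(Finset.mem_Icc.1 (hS hi)).1, (Finset.mem_Icc.1 (hS hj)).2⟩]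

namespace IsCell

theorem exists_base (h : IsCell E S) :
    ∃ i j, S ⊆ Finset.Icc i j ∧ i + 2 ≤ j ∧ (i, j) ∈ E := by
  have hne : S.Nonempty := Finset.card_pos.1 (by have := h.1; lia)
  have hsub : S ⊆ Finset.Icc (S.min' hne) (S.max' hne) := fun x hx =>
    Finset.mem_Icc.2 ⟨S.min'_le x hx, S.le_max' x hx⟩
  have hcard := h.1.trans (Finset.card_le_card hsub)
  rw [Nat.card_Icc] at hcard
  refine ⟨_, _, hsub, by lia,
    (h.2 _ (S.min'_mem hne) _ (S.max'_mem hne) (by lia)).1 (Or.inr fun c hc => ?_)⟩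
  have := Finset.mem_Icc.1 (hsub hc)
  lia

theorem exists_arc_over (h : IsCell E S) (hi : i ∈ S) (hj : j ∈ S) (hiv : i < v) (hvj : v < j)
    (hv : v ∉ S) :
    ∃ p q, (p, q) ∈ E ∧ p < v ∧ v < q ∧ ∀ c ∈ S, ¬ (p < c ∧ c < q) := by
  have hlow : (S.filter (· < v)).Nonempty := ⟨i, Finset.mem_filter.2 ⟨hi, hiv⟩⟩
  have hhigh : (S.filter (v < ·)).Nonempty := ⟨j, Finset.mem_filter.2 ⟨hj, hvj⟩⟩
  have hp := Finset.mem_filter.1 (Finset.max'_mem _ hlow)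
  have hq := Finset.mem_filter.1 (Finset.min'_mem _ hhigh)
  have hcon : ∀ c ∈ S, ¬ ((S.filter (· < v)).max' hlow < c ∧
      c < (S.filter (v < ·)).min' hhigh) := by
    rintro c hc ⟨hpc, hcq⟩
    rcases lt_trichotomy c v with hcv | rfl | hcv
    · exact (Finset.le_max' _ c (Finset.mem_filter.2 ⟨hc, hcv⟩)).not_gt hpc
    · exact hv hc
    · exact (Finset.min'_le _ c (Finset.mem_filter.2 ⟨hc, hcv⟩)).not_gt hcq
  exact ⟨_, _, (h.2 _ hp.1 _ hq.1 (hp.2.trans hq.2)).1 (Or.inl hcon), hp.2, hq.2, hcon⟩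

end IsCell

namespace ArcSystem

theorem subset_Icc (hE : ArcSystem a b E) (h : IsCell E S) : S ⊆ Finset.Icc a b := by
  obtain ⟨i, j, hS, -, hij⟩ := h.exists_base
  have hb := hE.bounds i j hij
  exact hS.trans (Finset.Icc_subset_Icc hb.1 hb.2.2)

theorem singleton (a : ℕ) : ArcSystem a (a + 1) {(a, a + 1)} where
  le := a.le_succ
  bounds i j h := by simp only [Finset.mem_singleton, Prod.mk.injEq] at h; lia
  side i _ _ := by simp only [Finset.mem_singleton, Prod.mk.injEq]; lia
  noncrossing i j k l h h' := by simp only [Finset.mem_singleton, Prod.mk.injEq] at h h'; lia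

theorem union (h₁ : ArcSystem a c E₁) (h₂ : ArcSystem c b E₂) : ArcSystem a b (E₁ ∪ E₂) where
  le := h₁.le.trans h₂.le
  bounds i j h := by
    have := h₁.le
    have := h₂.le
    rcases Finset.mem_union.1 h with h | h
    · have := h₁.bounds i j h
      lia
    · have := h₂.bounds i j h
      lia
  side i hai hib := by
    rcases lt_or_ge i c with hic | hci
    · exact Finset.mem_union_left _ (h₁.side i hai hic)
    · exact Finset.mem_union_right _ (h₂.side i hci hib)
  noncrossing i j k l h h' hik hkj := by
    rcases Finset.mem_union.1 h with h | h <;> rcases Finset.mem_union.1 h' with h' | h'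
    · exact h₁.noncrossing i j k l h h' hik hkj
    · have := h₁.bounds i j h
      have := h₂.bounds k l h'
      lia
    · have := h₂.bounds i j h
      have := h₁.bounds k l h'
      lia
    · exact h₂.noncrossing i j k l h h' hik hkj

theorem insert_base (hE : ArcSystem a b E) (hab : a < b) : ArcSystem a b (insert (a, b) E) where
  le := hE.le
  bounds i j h := by
    rcases Finset.mem_insert.1 h with h | h
    · simp only [Prod.mk.injEq] at h
      lia
    · exact hE.bounds i j h
  side i hai hib := Finset.mem_insert_of_mem (hE.side i hai hib)
  noncrossing i j k l h h' hik hkj := by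
    rcases Finset.mem_insert.1 h' with h' | h'
    · have : a ≤ i := by
        rcases Finset.mem_insert.1 h with h | h
        · simp only [Prod.mk.injEq] at h
          lia
        · exact (hE.bounds i j h).1
      simp only [Prod.mk.injEq] at h'
      lia
    · rcases Finset.mem_insert.1 h with h | h
      · have := hE.bounds k l h'
        simp only [Prod.mk.injEq] at h
        lia
      · exact hE.noncrossing i j k l h h' hik hkj

theorem erase_base (hE : ArcSystem a b E) (hab : a + 2 ≤ b) : ArcSystem a b (E.erase (a, b)) where
  le := hE.le
  bounds i j h := hE.bounds i j (Finset.mem_of_mem_erase h)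
  side i hai hib := by
    refine Finset.mem_erase.2 ⟨?_, hE.side i hai hib⟩
    simp only [ne_eq, Prod.mk.injEq]
    lia
  noncrossing i j k l h h' :=
    hE.noncrossing i j k l (Finset.mem_of_mem_erase h) (Finset.mem_of_mem_erase h')

protected theorem within (hE : ArcSystem a b E) (hax : a ≤ x) (hxy : x ≤ y) (hyb : y ≤ b) :
    ArcSystem x y (within E x y) where
  le := hxy
  bounds i j h := by
    obtain ⟨hij, hxi, hjy⟩ := mem_within.1 h
    exact ⟨hxi, (hE.bounds i j hij).2.1, hjy⟩
  side i hxi hiy := mem_within.2 ⟨hE.side i (by lia) (by lia), hxi, hiy⟩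
  noncrossing i j k l h h' :=
    hE.noncrossing i j k l (within_subset h) (within_subset h')

theorem within_self (hE : ArcSystem a b E) : within E a b = E :=
  Finset.filter_true_of_mem fun p hp => ⟨(hE.bounds p.1 p.2 hp).1, (hE.bounds p.1 p.2 hp).2.2⟩

theorem eq_singleton (hE : ArcSystem a (a + 1) E) : E = {(a, a + 1)} := by
  ext ⟨i, j⟩
  rw [Finset.mem_singleton, Prod.mk.injEq]
  refine ⟨fun h => ?_, ?_⟩
  · have := hE.bounds i j h
    lia
  · rintro ⟨rfl, rfl⟩
    exact hE.side i le_rfl i.lt_succ_self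

theorem right_le (h : ArcSystem a b E) (h' : ArcSystem a c E) : b ≤ c := by
  obtain rfl | hab := h.le.eq_or_lt
  · exact h'.le
  · have hside := h.side (b - 1) (by lia) (by lia)
    rw [Nat.sub_add_cancel (by lia)] at hside
    exact (h'.bounds _ _ hside).2.2

theorem right_unique (h : ArcSystem a b E) (h' : ArcSystem a c E) : b = c :=
  (h.right_le h').antisymm (h'.right_le h)

theorem base_notMem_union (h₁ : ArcSystem a c E₁) (h₂ : ArcSystem c b E₂) (hac : a < c)
    (hcb : c < b) : (a, b) ∉ E₁ ∪ E₂ := fun h => by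
  rcases Finset.mem_union.1 h with h | h
  · exact hcb.not_ge (h₁.bounds a b h).2.2
  · exact hac.not_ge (h₂.bounds a b h).1

theorem within_union_left (h₁ : ArcSystem a c E₁) (h₂ : ArcSystem c b E₂) :
    within (E₁ ∪ E₂) a c = E₁ := by
  ext ⟨i, j⟩
  rw [mem_within, Finset.mem_union]
  refine ⟨?_, fun h => ⟨Or.inl h, (h₁.bounds i j h).1, (h₁.bounds i j h).2.2⟩⟩
  rintro ⟨h | h, _, hjc⟩
  · exact h
  · have := h₂.bounds i j h
    lia

theorem within_union_right (h₁ : ArcSystem a c E₁) (h₂ : ArcSystem c b E₂) :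
    within (E₁ ∪ E₂) c b = E₂ := by
  ext ⟨i, j⟩
  rw [mem_within, Finset.mem_union]
  refine ⟨?_, fun h => ⟨Or.inr h, (h₂.bounds i j h).1, (h₂.bounds i j h).2.2⟩⟩
  rintro ⟨h | h, hci, _⟩
  · have := h₁.bounds i j h
    lia
  · exact h

theorem isCell_union (h₁ : ArcSystem a c E₁) (h₂ : ArcSystem c b E₂) :
    IsCell (E₁ ∪ E₂) S ↔ IsCell E₁ S ∨ IsCell E₂ S := by
  constructor
  · intro h
    obtain ⟨i, j, hS, -, hij⟩ := h.exists_base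
    rcases Finset.mem_union.1 hij with hij | hij
    · obtain ⟨hai, -, hjc⟩ := h₁.bounds i j hij
      rw [← isCell_within (hS.trans (Finset.Icc_subset_Icc hai hjc)), within_union_left h₁ h₂] at h
      exact Or.inl h
    · obtain ⟨hci, -, hjb⟩ := h₂.bounds i j hij
      rw [← isCell_within (hS.trans (Finset.Icc_subset_Icc hci hjb)), within_union_right h₁ h₂] at h
      exact Or.inr h
  · rintro (h | h)
    · rwa [← isCell_within (h₁.subset_Icc h), within_union_left h₁ h₂]
    · rwa [← isCell_within (h₂.subset_Icc h), within_union_right h₁ h₂]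

-- The cut point is recovered as the right end of the longest arc from `a`.
theorem union_inj (h₁ : ArcSystem a c E₁) (h₂ : ArcSystem c b E₂) (h₁' : ArcSystem a c' E₁')
    (h₂' : ArcSystem c' b' E₂') (hac : (a, c) ∈ E₁) (hac' : (a, c') ∈ E₁')
    (h : E₁ ∪ E₂ = E₁' ∪ E₂') : E₁ = E₁' ∧ c = c' ∧ E₂ = E₂' := by
  have hle : ∀ {x y z : ℕ} {F G : Finset (ℕ × ℕ)}, ArcSystem a y F → ArcSystem y z G →
      a < y → (a, x) ∈ F ∪ G → x ≤ y := fun hF hG hay hx =>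
    (Finset.mem_union.1 hx).elim (fun hx => (hF.bounds _ _ hx).2.2)
      fun hx => absurd (hG.bounds _ _ hx).1 hay.not_ge
  obtain rfl : c = c' := le_antisymm
    (hle h₁' h₂' (h₁'.bounds _ _ hac').2.1 (h ▸ Finset.mem_union_left _ hac))
    (hle h₁ h₂ (h₁.bounds _ _ hac).2.1 (h ▸ Finset.mem_union_left _ hac'))
  obtain rfl : b = b' := (h₁.union h₂).right_unique (h ▸ h₁'.union h₂')
  exact ⟨by rw [← within_union_left h₁ h₂, h, within_union_left h₁' h₂'], rfl,
    by rw [← within_union_right h₁ h₂, h, within_union_right h₁' h₂']⟩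

theorem left_mem_visible (hE : ArcSystem a b E) : a ∈ visible a b E :=
  mem_visible.2 ⟨⟨le_rfl, hE.le⟩, fun i j hij h => (hE.bounds i j hij).1.not_gt h.1⟩

theorem right_mem_visible (hE : ArcSystem a b E) : b ∈ visible a b E :=
  mem_visible.2 ⟨⟨hE.le, le_rfl⟩, fun i j hij h => (hE.bounds i j hij).2.2.not_gt h.2⟩

theorem visible_eq_pair (hE : ArcSystem a b E) (hab : (a, b) ∈ E) : visible a b E = {a, b} := by
  ext v
  rw [Finset.mem_insert, Finset.mem_singleton]
  refine ⟨fun hv => ?_, ?_⟩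
  · obtain ⟨hIcc, hv⟩ := mem_visible.1 hv
    have := hv a b hab
    lia
  · rintro (rfl | rfl)
    exacts [hE.left_mem_visible, hE.right_mem_visible]

theorem visible_union (h₁ : ArcSystem a c E₁) (h₂ : ArcSystem c b E₂) :
    visible a b (E₁ ∪ E₂) = visible a c E₁ ∪ visible c b E₂ := by
  have hac := h₁.le
  have hcb := h₂.le
  ext v
  simp only [Finset.mem_union, mem_visible, or_imp, forall_and]
  constructor
  · rintro ⟨hIcc, hv₁, hv₂⟩
    rcases le_total v c with hvc | hcv
    · exact Or.inl ⟨⟨hIcc.1, hvc⟩, hv₁⟩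
    · exact Or.inr ⟨⟨hcv, hIcc.2⟩, hv₂⟩
  · rintro (⟨hIcc, hv⟩ | ⟨hIcc, hv⟩)
    · refine ⟨by lia, hv, fun i j hij => ?_⟩
      have := h₂.bounds i j hij
      lia
    · refine ⟨by lia, fun i j hij => ?_, hv⟩
      have := h₁.bounds i j hij
      lia

theorem mem_of_consecutive_visible (hE : ArcSystem a b E) (hx : x ∈ visible a b E)
    (hy : y ∈ visible a b E) (hxy : x < y)
    (hcon : ∀ c ∈ visible a b E, ¬ (x < c ∧ c < y)) : (x, y) ∈ E := by
  obtain ⟨hxIcc, hx⟩ := mem_visible.1 hx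
  obtain ⟨hyIcc, hy⟩ := mem_visible.1 hy
  let ends := (Finset.Icc (x + 1) y).filter fun q => (x, q) ∈ E
  have mem_ends : ∀ q, q ∈ ends ↔ (x + 1 ≤ q ∧ q ≤ y) ∧ (x, q) ∈ E := by simp [ends]
  have hne : ends.Nonempty := ⟨x + 1, (mem_ends _).2 ⟨by lia, hE.side x hxIcc.1 (by lia)⟩⟩
  obtain ⟨q, hq, hmax⟩ := ends.exists_max_image id hne
  obtain ⟨hqIcc, hxq⟩ := (mem_ends q).1 hq
  obtain rfl | hqy := hqIcc.2.eq_or_lt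
  · exact hxq
  have hqVisible : q ∉ visible a b E := fun h => hcon q h ⟨by lia, hqy⟩
  rw [mem_visible] at hqVisible
  push Not at hqVisible
  obtain ⟨p, r, hpr, hpq, hqr⟩ := hqVisible ⟨by lia, by lia⟩
  have := hx p r hpr
  have := hy p r hpr
  have := hE.noncrossing x q p r hxq hpr
  obtain rfl : p = x := by lia
  exact absurd (hmax r ((mem_ends r).2 ⟨by lia, hpr⟩)) (not_le.2 hqr)

theorem isCell_insert_base_visible (hE : ArcSystem a b E) (hab : a < b) (hbase : (a, b) ∉ E) :
    IsCell (insert (a, b) E) (visible a b E) := by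
  have ha := hE.left_mem_visible
  have hb := hE.right_mem_visible
  have hIcc : ∀ v ∈ visible a b E, a ≤ v ∧ v ≤ b := fun v hv => (mem_visible.1 hv).1
  refine ⟨?_, fun x hx y hy hxy => ?_⟩
  · by_contra hcard
    refine hbase (hE.mem_of_consecutive_visible ha hb hab fun c hc hac => hcard ?_)
    rw [Nat.succ_le_iff, Finset.two_lt_card]
    exact ⟨a, ha, c, hc, b, hb, hac.1.ne, hab.ne, hac.2.ne⟩
  · rw [Finset.mem_insert, Prod.mk.injEq]
    refine ⟨?_, ?_⟩
    · rintro (hcon | houter)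
      · exact Or.inr (hE.mem_of_consecutive_visible hx hy hxy hcon)
      · have := houter a ha
        have := houter b hb
        have := hIcc x hx
        have := hIcc y hy
        lia
    · rintro (⟨rfl, rfl⟩ | hmem)
      · exact Or.inr fun c hc => by have := hIcc c hc; lia
      · exact Or.inl fun c hc => (mem_visible.1 hc).2 x y hmem

theorem subset_visible_of_isCell_insert_base (hE : ArcSystem a b E) (hab : a < b)
    (hbase : (a, b) ∉ E) (h : IsCell (insert (a, b) E) S) (ha : a ∈ S) (hb : b ∈ S) :
    S ⊆ visible a b E := by
  have hE' := hE.insert_base hab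
  intro v hv
  refine mem_visible.2 ⟨Finset.mem_Icc.1 (hE'.subset_Icc h hv), fun p q hpq hpvq => ?_⟩
  have hpqIcc := hE.bounds p q hpq
  -- An arc over `v` with an end outside `S` would cross an edge of the cell `S`.
  have hpS : p ∈ S := by
    by_contra hpS
    obtain ⟨r, s, hrs, hrp, hps, hcon⟩ := h.exists_arc_over ha hv
      (hpqIcc.1.lt_of_ne fun e => hpS (e ▸ ha)) hpvq.1 hpS
    have := hE'.noncrossing r s p q hrs (Finset.mem_insert_of_mem hpq) hrp hps
    have := hcon v hv
    lia
  have hqS : q ∈ S := by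
    by_contra hqS
    obtain ⟨r, s, hrs, hrq, hqs, hcon⟩ := h.exists_arc_over hv hb hpvq.2
      (hpqIcc.2.2.lt_of_ne fun e => hqS (e ▸ hb)) hqS
    have := hcon v hv
    have := hE'.noncrossing p q r s (Finset.mem_insert_of_mem hpq) hrs (by lia) hrq
    lia
  rcases (h.2 p hpS q hqS hpqIcc.2.1).2 (Finset.mem_insert_of_mem hpq) with hcon | houter
  · exact hcon v hv hpvq
  · have := houter a ha
    have := houter b hb
    obtain ⟨rfl, rfl⟩ : p = a ∧ q = b := by lia
    exact hbase hpq

theorem visible_subset_of_isCell_insert_base (hE : ArcSystem a b E) (hab : a < b)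
    (h : IsCell (insert (a, b) E) S) (ha : a ∈ S) (hb : b ∈ S) : visible a b E ⊆ S := by
  intro v hv
  obtain ⟨hvIcc, hv⟩ := mem_visible.1 hv
  by_contra hvS
  obtain ⟨p, q, hpq, hpv, hvq, hcon⟩ := h.exists_arc_over ha hb
    (hvIcc.1.lt_of_ne fun e => hvS (e ▸ ha)) (hvIcc.2.lt_of_ne fun e => hvS (e ▸ hb)) hvS
  rcases Finset.mem_insert.1 hpq with e | hpq
  · obtain ⟨rfl, rfl⟩ := Prod.mk.inj e
    obtain ⟨c, hc, hcpq⟩ : ∃ c ∈ S, c ∉ ({p, q} : Finset ℕ) :=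
      Finset.exists_mem_notMem_of_card_lt_card (Finset.card_le_two.trans_lt h.1)
    simp only [Finset.mem_insert, Finset.mem_singleton] at hcpq
    have := Finset.mem_Icc.1 ((hE.insert_base hab).subset_Icc h hc)
    have := hcon c hc
    lia
  · exact hv p q hpq ⟨hpv, hvq⟩

theorem isCell_insert_base (hE : ArcSystem a b E) (hab : a < b) (hbase : (a, b) ∉ E) :
    IsCell (insert (a, b) E) S ↔ S = visible a b E ∨ IsCell E S := by
  by_cases hS : a ∈ S ∧ b ∈ S
  · have hnot : ¬ IsCell E S := fun h => hbase <| (h.2 a hS.1 b hS.2 hab).1 <| Or.inr fun c hc => by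
      have := Finset.mem_Icc.1 (hE.subset_Icc h hc)
      lia
    rw [or_iff_left hnot]
    refine ⟨fun h => (hE.subset_visible_of_isCell_insert_base hab hbase h hS.1 hS.2).antisymm
      (hE.visible_subset_of_isCell_insert_base hab h hS.1 hS.2), ?_⟩
    rintro rfl
    exact hE.isCell_insert_base_visible hab hbase
  · have hne : S ≠ visible a b E := by
      rintro rfl
      exact hS ⟨hE.left_mem_visible, hE.right_mem_visible⟩
    rw [or_iff_right hne]
    refine and_congr_right fun _ => forall₂_congr fun x hx => forall₂_congr fun y hy => ?_
    rw [Finset.mem_insert, or_iff_right]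
    rintro ⟨⟩
    exact hS ⟨hx, hy⟩

end ArcSystem

end ArcSystems

theorem exists_eq_insert_of_card_eq_three {a b : ℕ} {S : Finset ℕ} (ha : a ∈ S) (hb : b ∈ S)
    (hab : a < b) (hS : S ⊆ Finset.Icc a b) (hcard : S.card = 3) :
    ∃ c, a < c ∧ c < b ∧ S = {a, c, b} := by
  have hb' : b ∈ S.erase a := Finset.mem_erase.2 ⟨hab.ne', hb⟩
  obtain ⟨c, hc⟩ : ∃ c, (S.erase a).erase b = {c} := by
    rw [← Finset.card_eq_one, Finset.card_erase_of_mem hb', Finset.card_erase_of_mem ha, hcard]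
  have hc' : c ∈ (S.erase a).erase b := hc ▸ Finset.mem_singleton_self c
  simp only [Finset.mem_erase] at hc'
  have hcIcc := Finset.mem_Icc.1 (hS hc'.2.2)
  refine ⟨c, by lia, by lia, ?_⟩
  rw [← Finset.insert_erase ha, ← Finset.insert_erase hb', hc, Finset.pair_comm]

theorem exists_eq_insert_of_card_eq_four {a b : ℕ} {S : Finset ℕ} (ha : a ∈ S) (hb : b ∈ S)
    (hab : a < b) (hS : S ⊆ Finset.Icc a b) (hcard : S.card = 4) :
    ∃ c d, a < c ∧ c < d ∧ d < b ∧ S = {a, c, d, b} := by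
  have hb' : b ∈ S.erase a := Finset.mem_erase.2 ⟨hab.ne', hb⟩
  obtain ⟨c, d, hcd, h⟩ : ∃ c d, c < d ∧ (S.erase a).erase b = {c, d} := by
    obtain ⟨c, d, hne, h⟩ := Finset.card_eq_two.1 (show ((S.erase a).erase b).card = 2 by
      rw [Finset.card_erase_of_mem hb', Finset.card_erase_of_mem ha, hcard])
    rcases hne.lt_or_gt with hlt | hlt
    · exact ⟨c, d, hlt, h⟩
    · exact ⟨d, c, hlt, h.trans (Finset.pair_comm c d)⟩
  have hmem : ∀ x ∈ ({c, d} : Finset ℕ), x ≠ b ∧ x ≠ a ∧ x ∈ S := by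
    simp only [← h, Finset.mem_erase, imp_self, implies_true]
  have hc := hmem c (by simp)
  have hd := hmem d (by simp)
  have hcIcc := Finset.mem_Icc.1 (hS hc.2.2)
  have hdIcc := Finset.mem_Icc.1 (hS hd.2.2)
  refine ⟨c, d, by lia, hcd, by lia, ?_⟩
  rw [← Finset.insert_erase ha, ← Finset.insert_erase hb', h, Finset.insert_comm b,
    Finset.pair_comm b]

namespace BTTree

/-- The sides and diagonals of the dissection dual to `t`, for a polygon on the points
`a, a + 1, …, a + t.leaves`: the root is the side `(a, a + t.leaves)` and the leaves are the
others. -/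
def edges : BTTree → ℕ → Finset (ℕ × ℕ)
  | leaf, a => {(a, a + 1)}
  | tri l r, a => insert (a, a + l.leaves + r.leaves) (l.edges a ∪ r.edges (a + l.leaves))
  | quad l c r, a => insert (a, a + l.leaves + c.leaves + r.leaves)
      (l.edges a ∪ (c.edges (a + l.leaves) ∪ r.edges (a + l.leaves + c.leaves)))

/-- The regions of the dissection dual to `t` of a polygon whose first vertex is `a`. -/
def cells : BTTree → ℕ → Finset (Finset ℕ)
  | leaf, _ => ∅
  | tri l r, a => insert {a, a + l.leaves, a + l.leaves + r.leaves}
      (l.cells a ∪ r.cells (a + l.leaves))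
  | quad l c r, a =>
      insert {a, a + l.leaves, a + l.leaves + c.leaves, a + l.leaves + c.leaves + r.leaves}
        (l.cells a ∪ (c.cells (a + l.leaves) ∪ r.cells (a + l.leaves + c.leaves)))

theorem base_mem_edges (t : BTTree) (a : ℕ) : (a, a + t.leaves) ∈ t.edges a := by
  cases t <;> simp [edges, leaves, add_assoc]

theorem arcSystem_edges (t : BTTree) (a : ℕ) : ArcSystem a (a + t.leaves) (t.edges a) := by
  induction t generalizing a with
  | leaf => exact ArcSystem.singleton a
  | tri l r ihl ihr =>
    have := l.leaves_pos
    rw [leaves, ← add_assoc]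
    exact ((ihl a).union (ihr _)).insert_base (by lia)
  | quad l c r ihl ihc ihr =>
    have := l.leaves_pos
    rw [leaves, ← add_assoc, ← add_assoc]
    exact ((ihl a).union ((ihc _).union (ihr _))).insert_base (by lia)

theorem visible_edges (t : BTTree) (a : ℕ) :
    visible a (a + t.leaves) (t.edges a) = {a, a + t.leaves} :=
  (t.arcSystem_edges a).visible_eq_pair (t.base_mem_edges a)

theorem isCell_edges_leaf {a : ℕ} {S : Finset ℕ} : ¬ IsCell (leaf.edges a) S := fun h => by
  obtain ⟨i, j, -, hij, harc⟩ := h.exists_base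
  simp only [edges, Finset.mem_singleton, Prod.mk.injEq] at harc
  lia

theorem isCell_edges_tri {l r : BTTree} {a : ℕ} {S : Finset ℕ} :
    IsCell ((tri l r).edges a) S ↔ S = {a, a + l.leaves, a + l.leaves + r.leaves} ∨
      IsCell (l.edges a) S ∨ IsCell (r.edges (a + l.leaves)) S := by
  have hl := l.leaves_pos
  have hr := r.leaves_pos
  have hL := l.arcSystem_edges a
  have hR := r.arcSystem_edges (a + l.leaves)
  rw [edges, (hL.union hR).isCell_insert_base (by lia)
    (hL.base_notMem_union hR (by lia) (by lia)), hL.isCell_union hR, hL.visible_union hR,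
    visible_edges, visible_edges, Finset.insert_union, Finset.singleton_union,
    Finset.insert_eq_of_mem (Finset.mem_insert_self _ _)]

theorem isCell_edges_quad {l c r : BTTree} {a : ℕ} {S : Finset ℕ} :
    IsCell ((quad l c r).edges a) S ↔
      S = {a, a + l.leaves, a + l.leaves + c.leaves, a + l.leaves + c.leaves + r.leaves} ∨
      IsCell (l.edges a) S ∨ IsCell (c.edges (a + l.leaves)) S ∨
      IsCell (r.edges (a + l.leaves + c.leaves)) S := by
  have hl := l.leaves_pos
  have hc := c.leaves_pos
  have hL := l.arcSystem_edges a
  have hC := c.arcSystem_edges (a + l.leaves)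
  have hR := r.arcSystem_edges (a + l.leaves + c.leaves)
  rw [edges, (hL.union (hC.union hR)).isCell_insert_base (by lia)
    (hL.base_notMem_union (hC.union hR) (by lia) (by lia)), hL.isCell_union (hC.union hR),
    hC.isCell_union hR, hL.visible_union (hC.union hR), hC.visible_union hR, visible_edges,
    visible_edges, visible_edges]
  simp only [Finset.insert_union, Finset.singleton_union, Finset.mem_insert, true_or,
    Finset.insert_eq_of_mem]

theorem mem_cells {t : BTTree} {a : ℕ} {S : Finset ℕ} :
    S ∈ t.cells a ↔ IsCell (t.edges a) S := by
  induction t generalizing a with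
  | leaf => simp only [cells, Finset.notMem_empty, isCell_edges_leaf]
  | tri l r ihl ihr =>
    simp only [cells, Finset.mem_insert, Finset.mem_union, ihl, ihr, isCell_edges_tri]
  | quad l c r ihl ihc ihr =>
    simp only [cells, Finset.mem_insert, Finset.mem_union, ihl, ihc, ihr, isCell_edges_quad]

theorem erase_base_edges_tri (l r : BTTree) (a : ℕ) :
    ((tri l r).edges a).erase (a, a + (tri l r).leaves) = l.edges a ∪ r.edges (a + l.leaves) := by
  have hl := l.leaves_pos
  have hr := r.leaves_pos
  rw [edges, leaves, ← add_assoc, Finset.erase_insert]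
  exact (l.arcSystem_edges a).base_notMem_union (r.arcSystem_edges _) (by lia) (by lia)

theorem erase_base_edges_quad (l c r : BTTree) (a : ℕ) :
    ((quad l c r).edges a).erase (a, a + (quad l c r).leaves) =
      l.edges a ∪ (c.edges (a + l.leaves) ∪ r.edges (a + l.leaves + c.leaves)) := by
  have hl := l.leaves_pos
  have hc := c.leaves_pos
  rw [edges, leaves, ← add_assoc, ← add_assoc, Finset.erase_insert]
  exact (l.arcSystem_edges a).base_notMem_union ((c.arcSystem_edges _).union (r.arcSystem_edges _))
    (by lia) (by lia)

theorem leaves_eq_of_edges_eq {s t : BTTree} {a : ℕ} (h : s.edges a = t.edges a) :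
    s.leaves = t.leaves :=
  Nat.add_left_cancel ((s.arcSystem_edges a).right_unique (h ▸ t.arcSystem_edges a))

theorem erase_base_edges_congr {s t : BTTree} {a : ℕ} (h : s.edges a = t.edges a) :
    (s.edges a).erase (a, a + s.leaves) = (t.edges a).erase (a, a + t.leaves) := by
  rw [h, leaves_eq_of_edges_eq h]

theorem edges_union_inj {s t : BTTree} {a b b' : ℕ} {E E' : Finset (ℕ × ℕ)}
    (hE : ArcSystem (a + s.leaves) b E) (hE' : ArcSystem (a + t.leaves) b' E')
    (h : s.edges a ∪ E = t.edges a ∪ E') : s.edges a = t.edges a ∧ E = E' := by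
  obtain ⟨hedges, -, hE⟩ := (s.arcSystem_edges a).union_inj hE (t.arcSystem_edges a) hE'
    (s.base_mem_edges a) (t.base_mem_edges a) h
  exact ⟨hedges, hE⟩

theorem edges_ne_union (t l r : BTTree) (a : ℕ) :
    t.edges a ≠ l.edges a ∪ r.edges (a + l.leaves) := fun h => by
  have hl := l.leaves_pos
  have hr := r.leaves_pos
  have hL := l.arcSystem_edges a
  have hR := r.arcSystem_edges (a + l.leaves)
  have hbase := t.base_mem_edges a
  rw [(t.arcSystem_edges a).right_unique (h ▸ hL.union hR), h] at hbase
  exact hL.base_notMem_union hR (by lia) (by lia) hbase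

theorem edges_tri_ne_edges_quad {l r l' c r' : BTTree} {a : ℕ} :
    (tri l r).edges a ≠ (quad l' c r').edges a := fun h => by
  have herase := erase_base_edges_congr h
  rw [erase_base_edges_tri, erase_base_edges_quad] at herase
  obtain ⟨hedges, hrest⟩ := edges_union_inj (r.arcSystem_edges _)
    ((c.arcSystem_edges _).union (r'.arcSystem_edges _)) herase
  rw [leaves_eq_of_edges_eq hedges] at hrest
  exact edges_ne_union r c r' _ hrest

theorem edges_leaf_ne_of_two_le {t : BTTree} {a : ℕ} (ht : 2 ≤ t.leaves) :
    leaf.edges a ≠ t.edges a := fun h => by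
  have hleaves := leaves_eq_of_edges_eq h
  rw [leaves] at hleaves
  lia

theorem two_le_leaves_tri (l r : BTTree) : 2 ≤ (tri l r).leaves := by
  have := l.leaves_pos
  have := r.leaves_pos
  rw [leaves]
  lia

theorem two_le_leaves_quad (l c r : BTTree) : 2 ≤ (quad l c r).leaves := by
  have := l.leaves_pos
  have := r.leaves_pos
  rw [leaves]
  lia

theorem edges_injective {s t : BTTree} {a : ℕ} (h : s.edges a = t.edges a) : s = t := by
  induction s generalizing a t with
  | leaf =>
    cases t with
    | leaf => rfl
    | tri l r => exact absurd h (edges_leaf_ne_of_two_le (two_le_leaves_tri l r))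
    | quad l c r => exact absurd h (edges_leaf_ne_of_two_le (two_le_leaves_quad l c r))
  | tri l r ihl ihr =>
    cases t with
    | leaf => exact absurd h.symm (edges_leaf_ne_of_two_le (two_le_leaves_tri l r))
    | tri l' r' =>
      have herase := erase_base_edges_congr h
      rw [erase_base_edges_tri, erase_base_edges_tri] at herase
      obtain ⟨hl, hr⟩ := edges_union_inj (r.arcSystem_edges _) (r'.arcSystem_edges _) herase
      obtain rfl := ihl hl
      rw [ihr hr]
    | quad l' c' r' => exact absurd h edges_tri_ne_edges_quad
  | quad l c r ihl ihc ihr =>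
    cases t with
    | leaf => exact absurd h.symm (edges_leaf_ne_of_two_le (two_le_leaves_quad l c r))
    | tri l' r' => exact absurd h.symm edges_tri_ne_edges_quad
    | quad l' c' r' =>
      have herase := erase_base_edges_congr h
      rw [erase_base_edges_quad, erase_base_edges_quad] at herase
      obtain ⟨hl, hcr⟩ := edges_union_inj ((c.arcSystem_edges _).union (r.arcSystem_edges _))
        ((c'.arcSystem_edges _).union (r'.arcSystem_edges _)) herase
      obtain rfl := ihl hl
      obtain ⟨hc, hr⟩ := edges_union_inj (r.arcSystem_edges _) (r'.arcSystem_edges _) hcr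
      obtain rfl := ihc hc
      rw [ihr hr]

theorem exists_edges_eq_insert_base {a b : ℕ} {E : Finset (ℕ × ℕ)} (hE : ArcSystem a b E)
    (hab : a < b) (hcard : (visible a b E).card = 3 ∨ (visible a b E).card = 4)
    (subtree : ∀ x ∈ visible a b E, ∀ y ∈ visible a b E, x < y → a < x ∨ y < b →
      (∀ c ∈ visible a b E, ¬ (x < c ∧ c < y)) →
      ∃ t : BTTree, x + t.leaves = y ∧ t.edges x = within E x y) :
    ∃ t : BTTree, a + t.leaves = b ∧ t.edges a = insert (a, b) E := by
  have ha := hE.left_mem_visible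
  have hb := hE.right_mem_visible
  have hIcc : visible a b E ⊆ Finset.Icc a b := Finset.filter_subset _ _
  rcases hcard with hcard | hcard
  · obtain ⟨c, hac, hcb, hvis⟩ := exists_eq_insert_of_card_eq_three ha hb hab hIcc hcard
    have hmem : ∀ v, v ∈ visible a b E ↔ v = a ∨ v = c ∨ v = b := by simp [hvis]
    have hc := (hmem c).2 (by lia)
    obtain ⟨l, rfl, hl⟩ := subtree a ha c hc hac (by lia) (by simp only [hmem]; lia)
    obtain ⟨r, rfl, hr⟩ := subtree _ hc b hb hcb (by lia) (by simp only [hmem]; lia)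
    refine ⟨tri l r, (add_assoc _ _ _).symm, ?_⟩
    rw [edges, hl, hr, within_union_within hc hac.le hcb.le, hE.within_self]
  · obtain ⟨c, d, hac, hcd, hdb, hvis⟩ := exists_eq_insert_of_card_eq_four ha hb hab hIcc hcard
    have hmem : ∀ v, v ∈ visible a b E ↔ v = a ∨ v = c ∨ v = d ∨ v = b := by simp [hvis]
    have hc := (hmem c).2 (by lia)
    have hd := (hmem d).2 (by lia)
    obtain ⟨l, rfl, hl⟩ := subtree a ha c hc hac (by lia) (by simp only [hmem]; lia)
    obtain ⟨m, rfl, hm⟩ := subtree _ hc d hd hcd (by lia) (by simp only [hmem]; lia)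
    obtain ⟨r, rfl, hr⟩ := subtree _ hd b hb hdb (by lia) (by simp only [hmem]; lia)
    refine ⟨quad l m r, by rw [leaves, ← add_assoc, ← add_assoc], ?_⟩
    rw [edges, hl, hm, hr, within_union_within hd hcd.le hdb.le,
      within_union_within hc hac.le (hcd.trans hdb).le, hE.within_self]

theorem exists_edges_eq {a b : ℕ} {E : Finset (ℕ × ℕ)} (hE : ArcSystem a b E) (hab : (a, b) ∈ E)
    (hcard : ∀ S, IsCell E S → S.card = 3 ∨ S.card = 4) :
    ∃ t : BTTree, a + t.leaves = b ∧ t.edges a = E := by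
  induction hm : b - a using Nat.strong_induction_on generalizing a b E with
  | _ m ih =>
    subst hm
    have hlt := (hE.bounds a b hab).2.1
    obtain rfl | hab₂ : b = a + 1 ∨ a + 2 ≤ b := by lia
    · exact ⟨leaf, rfl, hE.eq_singleton.symm⟩
    let F := E.erase (a, b)
    have hF : ArcSystem a b F := hE.erase_base hab₂
    have hinsert : insert (a, b) F = E := Finset.insert_erase hab
    have hcells : ∀ S, IsCell E S ↔ S = visible a b F ∨ IsCell F S := fun S => by
      rw [← hinsert, hF.isCell_insert_base hlt (Finset.notMem_erase _ _)]
    rw [← hinsert]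
    refine exists_edges_eq_insert_base hF hlt (hcard _ ((hcells _).2 (Or.inl rfl)))
      fun x hx y hy hxy hproper hcon => ?_
    have hxIcc := (mem_visible.1 hx).1
    have hyIcc := (mem_visible.1 hy).1
    have hW := hF.within hxIcc.1 hxy.le hyIcc.2
    have hxyW := mem_within.2 ⟨hF.mem_of_consecutive_visible hx hy hxy hcon, le_rfl, le_rfl⟩
    refine ih (y - x) (by lia) hW hxyW (fun S hS => ?_) rfl
    exact hcard S ((hcells S).2 (Or.inr ((isCell_within (hW.subset_Icc hS)).1 hS)))

theorem subset_Icc_of_mem_cells {t : BTTree} {a : ℕ} {S : Finset ℕ} (h : S ∈ t.cells a) :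
    S ⊆ Finset.Icc a (a + t.leaves) :=
  (t.arcSystem_edges a).subset_Icc (mem_cells.1 h)

theorem disjoint_cells {s t : BTTree} {a b : ℕ} (hab : a + s.leaves ≤ b) :
    Disjoint (s.cells a) (t.cells b) := by
  rw [Finset.disjoint_left]
  intro S hs ht
  have hsub : S ⊆ {b} := fun x hx => by
    have := Finset.mem_Icc.1 (subset_Icc_of_mem_cells hs hx)
    have := Finset.mem_Icc.1 (subset_Icc_of_mem_cells ht hx)
    rw [Finset.mem_singleton]
    lia
  have h3 := (mem_cells.1 hs).1.trans (Finset.card_le_card hsub)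
  rw [Finset.card_singleton] at h3
  lia

theorem card_triangle (l r : BTTree) (a : ℕ) :
    ({a, a + l.leaves, a + l.leaves + r.leaves} : Finset ℕ).card = 3 := by
  have := l.leaves_pos
  have := r.leaves_pos
  exact Finset.card_eq_three.2 ⟨_, _, _, by lia, by lia, by lia, rfl⟩

theorem card_quadrilateral (l c r : BTTree) (a : ℕ) :
    ({a, a + l.leaves, a + l.leaves + c.leaves, a + l.leaves + c.leaves + r.leaves} :
      Finset ℕ).card = 4 := by
  have := l.leaves_pos
  have := c.leaves_pos
  have := r.leaves_pos
  exact Finset.card_eq_four.2 ⟨_, _, _, _, by lia, by lia, by lia, by lia, by lia, by lia, rfl⟩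

theorem quadrilateral_notMem_cells (l c r : BTTree) (a : ℕ) :
    {a, a + l.leaves, a + l.leaves + c.leaves, a + l.leaves + c.leaves + r.leaves} ∉
      l.cells a ∪ (c.cells (a + l.leaves) ∪ r.cells (a + l.leaves + c.leaves)) := by
  have hl := l.leaves_pos
  have hr := r.leaves_pos
  simp only [Finset.mem_union]
  rintro (h | h | h)
  · have := subset_Icc_of_mem_cells h
      (show a + l.leaves + c.leaves + r.leaves ∈ _ by simp)
    rw [Finset.mem_Icc] at this
    lia
  all_goals
    have := Finset.mem_Icc.1 (subset_Icc_of_mem_cells h (Finset.mem_insert_self _ _))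
    lia

theorem card_of_mem_cells {t : BTTree} {a : ℕ} {S : Finset ℕ} (h : S ∈ t.cells a) :
    S.card = 3 ∨ S.card = 4 := by
  induction t generalizing a with
  | leaf => exact absurd h (Finset.notMem_empty S)
  | tri l r ihl ihr =>
    simp only [cells, Finset.mem_insert, Finset.mem_union] at h
    rcases h with rfl | h | h
    · exact Or.inl (l.card_triangle r a)
    · exact ihl h
    · exact ihr h
  | quad l c r ihl ihc ihr =>
    simp only [cells, Finset.mem_insert, Finset.mem_union] at h
    rcases h with rfl | h | h | h
    · exact Or.inr (l.card_quadrilateral c r a)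
    · exact ihl h
    · exact ihc h
    · exact ihr h

theorem card_filter_cells (t : BTTree) (a : ℕ) :
    ((t.cells a).filter fun S => S.card = 4).card = t.quads := by
  induction t generalizing a with
  | leaf => rfl
  | tri l r ihl ihr =>
    rw [cells, quads, Finset.filter_insert, if_neg (by rw [card_triangle]; lia),
      Finset.filter_union,
      Finset.card_union_of_disjoint (Finset.disjoint_filter_filter (disjoint_cells le_rfl)),
      ihl, ihr]
  | quad l c r ihl ihc ihr =>
    have hroot := l.quadrilateral_notMem_cells c r a
    have hdisj : Disjoint (l.cells a)
        (c.cells (a + l.leaves) ∪ r.cells (a + l.leaves + c.leaves)) :=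
      Finset.disjoint_union_right.2
        ⟨disjoint_cells le_rfl, disjoint_cells (Nat.le_add_right _ _)⟩
    rw [cells, quads, Finset.filter_insert, if_pos (card_quadrilateral l c r a),
      Finset.card_insert_of_notMem fun h => hroot (Finset.mem_filter.1 h).1, Finset.filter_union,
      Finset.card_union_of_disjoint (Finset.disjoint_filter_filter hdisj), Finset.filter_union,
      Finset.card_union_of_disjoint (Finset.disjoint_filter_filter (disjoint_cells le_rfl)),
      ihl, ihc, ihr]
    lia

end BTTree

section Dissections

variable {n k : ℕ}

/-- The sides and the diagonals of a dissection of the polygon with vertices `0, …, n + 1`. -/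
def Dissection.edges (D : Dissection (n + 2)) : Finset (ℕ × ℕ) :=
  insert (0, n + 1) (D.diagonals.image (fun d => ((d.1 : ℕ), (d.2 : ℕ))) ∪
    (Finset.range (n + 1)).image fun i => (i, i + 1))

namespace Dissection

theorem mem_edges {D : Dissection (n + 2)} {i j : ℕ} :
    (i, j) ∈ D.edges ↔ (i = 0 ∧ j = n + 1) ∨
      (∃ d ∈ D.diagonals, (d.1 : ℕ) = i ∧ (d.2 : ℕ) = j) ∨ (i < n + 1 ∧ j = i + 1) := by
  simp only [edges, Finset.mem_insert, Finset.mem_union, Finset.mem_image, Prod.mk.injEq,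
    Finset.mem_range]
  grind

theorem base_mem_edges (D : Dissection (n + 2)) : (0, n + 1) ∈ D.edges :=
  mem_edges.2 (Or.inl ⟨rfl, rfl⟩)

theorem coe_mem_edges {D : Dissection (n + 2)} {a b : Fin (n + 2)} :
    ((a : ℕ), (b : ℕ)) ∈ D.edges ↔ IsSide a b ∨ (a, b) ∈ D.diagonals := by
  have hdiag : (∃ d ∈ D.diagonals, (d.1 : ℕ) = a ∧ (d.2 : ℕ) = b) ↔ (a, b) ∈ D.diagonals := by
    simp only [Prod.exists, ← Fin.ext_iff, existsAndEq, and_true]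
  rw [mem_edges, hdiag, IsSide]
  lia

theorem arcSystem (D : Dissection (n + 2)) : ArcSystem 0 (n + 1) D.edges where
  le := Nat.zero_le _
  bounds i j h := by
    rcases mem_edges.1 h with h | ⟨d, hd, rfl, rfl⟩ | h
    · lia
    · have := Fin.lt_def.1 (D.isDiagonal d hd).1
      lia
    · lia
  side i _ h := mem_edges.2 (Or.inr (Or.inr ⟨h, rfl⟩))
  noncrossing i j k l h h' hik hkj := by
    rcases mem_edges.1 h' with h' | ⟨e, he, rfl, rfl⟩ | h'
    · lia
    · rcases mem_edges.1 h with h | ⟨d, hd, rfl, rfl⟩ | h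
      · lia
      · by_contra hlt
        exact D.noncrossing d hd e he ⟨hik, hkj, not_le.1 hlt⟩
      · lia
    · lia

theorem edges_injective : Function.Injective (edges (n := n)) := by
  have hsub : ∀ D D' : Dissection (n + 2), D.edges = D'.edges → D.diagonals ⊆ D'.diagonals := by
    rintro D D' h ⟨a, b⟩ hab
    exact (coe_mem_edges.1 (h ▸ coe_mem_edges.2 (Or.inr hab))).resolve_left (D.isDiagonal _ hab).2
  intro D D' h
  have hdiag := (hsub D D' h).antisymm (hsub D' D h.symm)
  cases D
  cases D'
  exact (mk.injEq ..).mpr hdiag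

theorem isRegion_iff_isCell {D : Dissection (n + 2)} {S : Finset (Fin (n + 2))} :
    D.IsRegion S ↔ IsCell D.edges (S.map Fin.valEmbedding) := by
  simp only [IsRegion, IsCell, Finset.card_map, Finset.forall_mem_map, Fin.valEmbedding_apply,
    coe_mem_edges, Adjacent, Neighbours, Fin.lt_def]

theorem isCell_iff_exists_isRegion {D : Dissection (n + 2)} {S : Finset ℕ} :
    IsCell D.edges S ↔ ∃ T, D.IsRegion T ∧ T.map Fin.valEmbedding = S := by
  refine ⟨fun h => ?_, ?_⟩
  · have hlt : ∀ m ∈ S, m < n + 2 := fun m hm => by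
      have := Finset.mem_Icc.1 (D.arcSystem.subset_Icc h hm)
      lia
    have hmap : (S.attachFin hlt).map Fin.valEmbedding = S := Finset.map_valEmbedding_attachFin hlt
    exact ⟨S.attachFin hlt, isRegion_iff_isCell.2 (hmap.symm ▸ h), hmap⟩
  · rintro ⟨T, hT, rfl⟩
    exact isRegion_iff_isCell.1 hT

theorem forall_isRegion_card_iff {D : Dissection (n + 2)} {P : ℕ → Prop} :
    (∀ S, D.IsRegion S → P S.card) ↔ ∀ S, IsCell D.edges S → P S.card := by
  simp only [isCell_iff_exists_isRegion, forall_exists_index, and_imp, forall_apply_eq_imp_iff₂,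
    Finset.card_map]

theorem quadrilaterals_eq_ncard_isCell (D : Dissection (n + 2)) :
    D.quadrilaterals = {S : Finset ℕ | IsCell D.edges S ∧ S.card = 4}.ncard := by
  rw [quadrilaterals, ← Set.ncard_image_of_injective _
    (Finset.map_injective (Fin.valEmbedding (n := n + 2)))]
  congr 1
  ext S
  rw [Set.mem_image, Set.mem_ofPred_eq, isCell_iff_exists_isRegion]
  constructor
  · rintro ⟨T, ⟨hT, hcard⟩, rfl⟩
    exact ⟨⟨T, hT, rfl⟩, by rwa [Finset.card_map]⟩
  · rintro ⟨⟨T, hT, rfl⟩, hcard⟩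
    rw [Finset.card_map] at hcard
    exact ⟨T, ⟨hT, hcard⟩, rfl⟩

theorem quadrilaterals_eq_quads {D : Dissection (n + 2)} {t : BTTree} (h : t.edges 0 = D.edges) :
    D.quadrilaterals = t.quads := by
  rw [quadrilaterals_eq_ncard_isCell, ← t.card_filter_cells 0, ← Set.ncard_coe_finset]
  congr 1
  ext S
  simp only [Set.mem_ofPred_eq, Finset.coe_filter, BTTree.mem_cells, h]

end Dissection

open Classical in
/-- The dissection whose diagonals are the arcs of `E` that are not sides of the polygon. -/
noncomputable def ArcSystem.dissection {E : Finset (ℕ × ℕ)} (hE : ArcSystem 0 (n + 1) E) :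
    Dissection (n + 2) where
  diagonals := Finset.univ.filter fun d : Fin (n + 2) × Fin (n + 2) =>
    ((d.1 : ℕ), (d.2 : ℕ)) ∈ E ∧ ¬ IsSide d.1 d.2
  isDiagonal d hd := by
    have h := (Finset.mem_filter.1 hd).2
    exact ⟨Fin.lt_def.2 (hE.bounds _ _ h.1).2.1, h.2⟩
  noncrossing d hd e he h :=
    (hE.noncrossing _ _ _ _ (Finset.mem_filter.1 hd).2.1 (Finset.mem_filter.1 he).2.1
      h.1 h.2.1).not_gt h.2.2

theorem ArcSystem.edges_dissection {E : Finset (ℕ × ℕ)} (hE : ArcSystem 0 (n + 1) E)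
    (hbase : (0, n + 1) ∈ E) : hE.dissection.edges = E := by
  classical
  have hcoe : ∀ a b : Fin (n + 2), ((a : ℕ), (b : ℕ)) ∈ hE.dissection.edges ↔ (↑a, ↑b) ∈ E := by
    intro a b
    have hside : IsSide a b → ((a : ℕ), (b : ℕ)) ∈ E := by
      rintro (h | ⟨ha, hb⟩)
      · exact h ▸ hE.side a (Nat.zero_le _) (by lia)
      · rwa [ha, show (b : ℕ) = n + 1 by lia]
    rw [Dissection.coe_mem_edges, dissection, Finset.mem_filter, and_iff_right (Finset.mem_univ _)]
    tauto
  ext ⟨i, j⟩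
  by_cases hij : i < n + 2 ∧ j < n + 2
  · exact hcoe ⟨i, hij.1⟩ ⟨j, hij.2⟩
  · refine iff_of_false (fun h => hij ?_) fun h => hij ?_
    · have := hE.dissection.arcSystem.bounds i j h
      lia
    · have := hE.bounds i j h
      lia

theorem BTTree.exists_dissection {t : BTTree} (ht : t ∈ treesWith n k) :
    ∃ D : {D : TriQuadDissection (n + 2) // D.1.quadrilaterals = k}, D.1.1.edges = t.edges 0 := by
  obtain ⟨hleaves, rfl⟩ := ht
  have hE := t.arcSystem_edges 0
  have hbase := t.base_mem_edges 0
  rw [hleaves, zero_add] at hE hbase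
  have hD := hE.edges_dissection hbase
  refine ⟨⟨⟨hE.dissection, (Dissection.forall_isRegion_card_iff
    (P := fun m => m = 3 ∨ m = 4)).2 fun S hS => ?_⟩,
    Dissection.quadrilaterals_eq_quads hD.symm⟩, hD⟩
  rw [hD, ← mem_cells] at hS
  exact card_of_mem_cells hS

theorem card_dissections_with_quadrilaterals (n k : ℕ) :
    Nat.card {D : TriQuadDissection (n + 2) // D.1.quadrilaterals = k} =
      (BTTree.treesWith n k).ncard := by
  choose f hf using fun t : BTTree.treesWith n k => BTTree.exists_dissection t.2
  rw [← Nat.card_coe_set_eq]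
  refine (Nat.card_congr (Equiv.ofBijective f ⟨fun t t' h => ?_, ?_⟩)).symm
  · refine Subtype.ext (BTTree.edges_injective (a := 0) ?_)
    rw [← hf, ← hf, h]
  · rintro ⟨⟨D, hD⟩, hk⟩
    obtain ⟨t, hleaves, hedges⟩ := BTTree.exists_edges_eq D.arcSystem D.base_mem_edges
      (Dissection.forall_isRegion_card_iff (P := fun m => m = 3 ∨ m = 4).1 hD)
    have ht : t ∈ BTTree.treesWith n k :=
      ⟨by lia, (Dissection.quadrilaterals_eq_quads hedges).symm.trans hk⟩
    refine ⟨⟨t, ht⟩, Subtype.ext (Subtype.ext (Dissection.edges_injective ?_))⟩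
    rw [hf, hedges]

instance finite_triQuadDissection (N : ℕ) : Finite (TriQuadDissection N) :=
  Finite.of_injective (fun D : TriQuadDissection N => D.1.diagonals) fun D D' h => by
    obtain ⟨⟨_, _, _⟩, _⟩ := D
    obtain ⟨⟨_, _, _⟩, _⟩ := D'
    exact Subtype.ext ((Dissection.mk.injEq ..).mpr h)

end Dissections

section Conclusion

variable {α β : Type*} {n : ℕ}

theorem natCard_eq_sum_natCard_fiber [Finite α] {f : α → ℕ} {m : ℕ} (hf : ∀ a, f a < m) :
    Nat.card α = ∑ k ∈ Finset.range m, Nat.card {a // f a = k} := by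
  classical
  have := Fintype.ofFinite α
  simp only [Nat.card_eq_fintype_card, Fintype.card_subtype]
  exact Finset.card_eq_sum_card_fiberwise fun a _ => Finset.mem_coe.2 (Finset.mem_range.2 (hf a))

theorem natCard_eq_sum_of_fiber [Finite α] {f : α → ℕ}
    (hf : ∀ k, (n + 1) * Nat.card {a // f a = k} =
      (2 * n - k).choose (n + k) * (n + k).choose k) :
    (Nat.card α : ℚ) = ∑ k ∈ Finset.range (n / 2 + 1),
      1 / ((n : ℚ) + 1) * (Nat.choose (2 * n - k) (n + k) : ℚ) * (Nat.choose (n + k) k : ℚ) := by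
  have hlt : ∀ a, f a < n / 2 + 1 := by
    intro a
    by_contra ha
    have : Nonempty {b // f b = f a} := ⟨a, rfl⟩
    have hzero := hf (f a)
    rw [Nat.choose_eq_zero_of_lt (by lia), zero_mul] at hzero
    exact (Nat.mul_pos n.succ_pos Nat.card_pos).ne' hzero
  rw [natCard_eq_sum_natCard_fiber hlt, Nat.cast_sum]
  refine Finset.sum_congr rfl fun k _ => ?_
  have hk : ((n : ℚ) + 1) * Nat.card {a // f a = k} =
      (2 * n - k).choose (n + k) * (n + k).choose k := by exact_mod_cast hf k
  rw [mul_assoc, ← hk]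
  field_simp

theorem exists_equiv_of_natCard_fiber_eq [Finite α] [Finite β] {f : α → ℕ} {g : β → ℕ}
    (h : ∀ k, Nat.card {a // f a = k} = Nat.card {b // g b = k}) :
    ∃ e : α ≃ β, ∀ a, g (e a) = f a := by
  have fiberEquiv : ∀ k, Nonempty ({a // f a = k} ≃ {b // g b = k}) := fun k =>
    Finite.card_eq.1 (h k)
  exact ⟨Equiv.ofFiberEquiv fun k => (fiberEquiv k).some, fun a => Equiv.ofFiberEquiv_map _ a⟩

end Conclusion

end PatternParking

theorem theoremT :
    (∀ n : ℕ, (PatternParking.pf n PatternParking.patterns : ℚ) =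
      ∑ k ∈ Finset.range (n / 2 + 1),
        1 / ((n : ℚ) + 1) * (Nat.choose (2 * n - k) (n + k) : ℚ) * (Nat.choose (n + k) k : ℚ)) ∧
    (∀ n : ℕ, 1 ≤ n → (Nat.card (PatternParking.TriQuadDissection (n + 2)) : ℚ) =
      ∑ k ∈ Finset.range (n / 2 + 1),
        1 / ((n : ℚ) + 1) * (Nat.choose (2 * n - k) (n + k) : ℚ) * (Nat.choose (n + k) k : ℚ)) ∧
    (∀ n : ℕ, 1 ≤ n →
      ∃ e : PatternParking.AvoidingParkingFunction n PatternParking.patterns ≃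
          PatternParking.TriQuadDissection (n + 2),
        ∀ p : PatternParking.AvoidingParkingFunction n PatternParking.patterns,
          (e p).1.quadrilaterals = PatternParking.descents p.1.perm) := by
  have hp : ∀ n k, (n + 1) * Nat.card {p : PatternParking.AvoidingParkingFunction n
      PatternParking.patterns // PatternParking.descents p.1.perm = k} =
      (2 * n - k).choose (n + k) * (n + k).choose k := fun n k => by
    rw [PatternParking.card_avoiding_with_descents, PatternParking.succ_mul_ncard_closedPrefixes]
  have hD : ∀ n k, (n + 1) * Nat.card {D : PatternParking.TriQuadDissection (n + 2) //
      D.1.quadrilaterals = k} = (2 * n - k).choose (n + k) * (n + k).choose k := fun n k => by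
    rw [PatternParking.card_dissections_with_quadrilaterals,
      PatternParking.BTTree.succ_mul_ncard_treesWith]
  exact ⟨fun n => PatternParking.natCard_eq_sum_of_fiber (hp n),
    fun n _ => PatternParking.natCard_eq_sum_of_fiber (hD n),
    fun n _ => PatternParking.exists_equiv_of_natCard_fiber_eq fun k =>
      Nat.eq_of_mul_eq_mul_left n.succ_pos ((hp n k).trans (hD n k).symm)⟩
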